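/- Let $\mathcal Y\subset\mathbb R^d$ be a finite set whose convex hull $\mathcal C$ has non-empty interior, and let $\varepsilon>0$. Let $Z$ be a random vector in $\mathbb R^d$ with law $\mu$ having positive differentiable density $d\mu(z)\propto \exp(-\nu(z))\,dz$, with $\mathbf E\|Z\|<\infty$ and $\mathbf E\|\nabla\nu(Z)\|<\infty$. For $\theta\in\mathbb R^d$ put $F(\theta)=\max_{y\in\mathcal C}\langle y,\theta\rangle$ and $y^*(\theta)=\operatorname{argmax}_{y\in\mathcal C}\langle y,\theta\rangle$ (uniquely defined for almost every $\theta$), and let $F_\varepsilon(\theta)=\mathbf E[F(\theta+\varepsilon Z)]$, $y^*_\varepsilon(\theta)=\mathbf E[y^*(\theta+\varepsilon Z)]$, let $p_\theta$ be the law of $y^*(\theta+\varepsilon Z)$, let $\Omega(y)=\sup_{\theta}\{\langle y,\theta\rangle-F_1(\theta)\}$ be the Fenchel dual of $F_1$, and let $L_\varepsilon(\theta;y)=F_\varepsilon(\theta)+\varepsilon\,\Omega(y)-\langle\theta,y\rangle$ be the Fenchel–Young loss. Let $\theta_0\in\mathbb R^d$, let $y_1,y_2,\dots$ be i.i.d.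 with law $p_{\theta_0}$, let $\bar Y_n=\frac1n\sum_{i=1}^n y_i$ and $\bar L_{\varepsilon,n}(\theta)=\frac1n\sum_{i=1}^n L_\varepsilon(\theta;y_i)$. Let $\hat\theta_n$ be random vectors such that, for every $n$, almost surely $\hat\theta_n$ minimizes $\bar L_{\varepsilon,n}$ over $\mathbb R^d$ whenever a minimizer exists. Then, almost surely, for all $n$ large enough $\hat\theta_n$ is a minimizer and $y^*_\varepsilon(\hat\theta_n)=\bar Y_n$. Moreover $F_\varepsilon$ is differentiable, its gradient is differentiable at $\theta_0$, the Hessian $H=\nabla^2F_\varepsilon(\theta_0)$ is invertible, and, as $n\to\infty$, $$\sqrt n\,(\hat\theta_n-\theta_0)\to\mathcal N\big(0,\;H^{-1}\,\Sigma_Y\,H^{-1}\big)\quad\text{in distribution,}$$ where $\Sigma_Y$ is the covariance matrix of $Y\sim p_{\theta_0}$. -/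

import Mathlib

open MeasureTheory ProbabilityTheory Filter Topology

noncomputable section

namespace PerturbedModel

variable {d : ℕ}

/-- The polytope `C`, convex hull of the finite set `Y`. -/
def polytope (Y : Finset (EuclideanSpace ℝ (Fin d))) : Set (EuclideanSpace ℝ (Fin d)) :=
  convexHull ℝ (Y : Set (EuclideanSpace ℝ (Fin d)))

/-- `F(θ) = max_{y ∈ C} ⟨y, θ⟩`; the supremum is attained as soon as `Y` is nonempty. -/
def maxValue (Y : Finset (EuclideanSpace ℝ (Fin d))) (θ : EuclideanSpace ℝ (Fin d)) : ℝ :=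
  sSup ((fun y => inner ℝ y θ) '' polytope Y)

open Classical in
/-- `y*(θ) = argmax_{y ∈ C} ⟨y, θ⟩` when the maximizer is unique. The value `0` at the
exceptional `θ` (a null set when `C` has nonempty interior) is only a convention. -/
def maximizer (Y : Finset (EuclideanSpace ℝ (Fin d))) (θ : EuclideanSpace ℝ (Fin d)) :
    EuclideanSpace ℝ (Fin d) :=
  if h : ∃! y, y ∈ polytope Y ∧ ∀ y' ∈ polytope Y, (inner ℝ y' θ : ℝ) ≤ inner ℝ y θ then
    h.choose
  else 0

/-- The noise distribution `μ`, with density proportional to `exp (-ν)`. -/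
def noise (ν : EuclideanSpace ℝ (Fin d) → ℝ) : Measure (EuclideanSpace ℝ (Fin d)) :=
  (volume : Measure (EuclideanSpace ℝ (Fin d))).tilted (fun z => -ν z)

/-- The perturbed model `p_θ`: the law of `y*(θ + ε Z)` for `Z ∼ μ`. -/
def model (Y : Finset (EuclideanSpace ℝ (Fin d))) (ν : EuclideanSpace ℝ (Fin d) → ℝ) (ε : ℝ)
    (θ : EuclideanSpace ℝ (Fin d)) : Measure (EuclideanSpace ℝ (Fin d)) :=
  (noise ν).map (fun z => maximizer Y (θ + ε • z))

/-- The perturbed maximum `F_ε(θ) = E[F(θ + ε Z)]`. -/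
def perturbedMax (Y : Finset (EuclideanSpace ℝ (Fin d))) (ν : EuclideanSpace ℝ (Fin d) → ℝ)
    (ε : ℝ) (θ : EuclideanSpace ℝ (Fin d)) : ℝ :=
  ∫ z, maxValue Y (θ + ε • z) ∂(noise ν)

/-- The perturbed maximizer `y*_ε(θ) = E[y*(θ + ε Z)]`. -/
def perturbedMaximizer (Y : Finset (EuclideanSpace ℝ (Fin d)))
    (ν : EuclideanSpace ℝ (Fin d) → ℝ) (ε : ℝ) (θ : EuclideanSpace ℝ (Fin d)) :
    EuclideanSpace ℝ (Fin d) :=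
  ∫ z, maximizer Y (θ + ε • z) ∂(noise ν)

/-- The regularizer `Ω`, Fenchel dual of `F_1`. Its domain is `C`; it is only used at points
of `C`, where the supremum is finite when `Z` is integrable. -/
def regularizer (Y : Finset (EuclideanSpace ℝ (Fin d))) (ν : EuclideanSpace ℝ (Fin d) → ℝ)
    (y : EuclideanSpace ℝ (Fin d)) : ℝ :=
  ⨆ θ : EuclideanSpace ℝ (Fin d), (inner ℝ y θ - perturbedMax Y ν 1 θ)

/-- The Fenchel-Young loss `L_ε(θ; y) = F_ε(θ) + ε Ω(y) - ⟨θ, y⟩`. -/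
def fyLoss (Y : Finset (EuclideanSpace ℝ (Fin d))) (ν : EuclideanSpace ℝ (Fin d) → ℝ) (ε : ℝ)
    (θ y : EuclideanSpace ℝ (Fin d)) : ℝ :=
  perturbedMax Y ν ε θ + ε * regularizer Y ν y - inner ℝ θ y

/-- The empirical loss of the first `n` observations. -/
def empiricalLoss (Y : Finset (EuclideanSpace ℝ (Fin d))) (ν : EuclideanSpace ℝ (Fin d) → ℝ)
    (ε : ℝ) (y : ℕ → EuclideanSpace ℝ (Fin d)) (n : ℕ) (θ : EuclideanSpace ℝ (Fin d)) : ℝ :=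
  (n : ℝ)⁻¹ * ∑ i ∈ Finset.range n, fyLoss Y ν ε θ (y i)

/-- The sample mean of the first `n` observations. -/
def sampleMean (y : ℕ → EuclideanSpace ℝ (Fin d)) (n : ℕ) : EuclideanSpace ℝ (Fin d) :=
  (n : ℝ)⁻¹ • ∑ i ∈ Finset.range n, y i

/-- The Hessian matrix of `G` at `θ`, i.e. the Jacobian matrix of the gradient of `G`. -/
def hessian (G : EuclideanSpace ℝ (Fin d) → ℝ) (θ : EuclideanSpace ℝ (Fin d)) :
    Matrix (Fin d) (Fin d) ℝ :=
  Matrix.of fun i j => (fderiv ℝ (gradient G) θ (EuclideanSpace.single j 1)) i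

/-- The covariance matrix of a distribution on `ℝ^d`. -/
def covarianceMatrix (p : Measure (EuclideanSpace ℝ (Fin d))) : Matrix (Fin d) (Fin d) ℝ :=
  Matrix.of fun i j => covariance (fun y => y i) (fun y => y j) p

end PerturbedModel

end

/-!
Write `G` for the perturbed maximizer `y*_ε`. Differentiating under the integral, `F_ε` is convex
and differentiable with gradient `G`, and the empirical loss of `n ≥ 1` observations is `F_ε - ⟨·,
Ȳ_n⟩` up to a constant; hence its minimizers are exactly the solutions of `G θ = Ȳ_n`
(`isMinOn_empiricalLoss_iff`). Three facts about `G` give the result.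

* `G` is strictly differentiable. After a substitution `G θ = ∫ f (u - θ / ε) y*(ε u) du`, with
  `f` the density of the noise. As `f` is differentiable with `∇f` integrable, and translations
  are continuous in `L¹`, the derivative may be taken on `f`, although `∇f` need not be continuous
  (`hasStrictFDerivAt_integral_translate_smul`).
* `G` is strictly monotone, with increments bounded below linearly in the step
  (`exists_le_inner_perturbedMaximizer_sub`): the maximizer is monotone along lines, it has a
  nontrivial total increment along each line as the polytope has interior points, and the density
  is bounded below on compact sets. So `G` is injective and its derivative `H` at `θ₀` is
  invertible; `H` is symmetric as a second derivative.
* By the inverse function theorem `G` has a local inverse `ψ` near `G θ₀`, differentiable with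
  derivative `H⁻¹` at `G θ₀`.

By the strong law of large numbers `Ȳ_n` tends almost surely to `E y_1 = G θ₀`, so that eventually
`G (ψ Ȳ_n) = Ȳ_n`. Then a minimizer exists, the estimator solves `G θ = Ȳ_n`, and it equals `ψ
Ȳ_n` since `G` is injective. The multivariate central limit theorem for `Ȳ_n` and the delta method
for `ψ` give the limit law, the image of `N(0, Σ_Y)` under the symmetric matrix `H⁻¹`.
-/

/-! ### Integrals against translates of an integrable function -/

/-- A function whose increments are the integrals along segments of a continuous field `D` of
linear maps is strictly differentiable, with derivative `D`. -/
theorem hasStrictFDerivAt_of_sub_eq_intervalIntegral {E V : Type*} [NormedAddCommGroup E]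
    [NormedSpace ℝ E] [NormedAddCommGroup V] [NormedSpace ℝ V] [CompleteSpace V] {g : E → V}
    {D : E → E →L[ℝ] V} (hD : Continuous D)
    (hg : ∀ a b, g b - g a = ∫ t in (0 : ℝ)..1, D (a + t • (b - a)) (b - a)) (x : E) :
    HasStrictFDerivAt g (D x) x := by
  refine hasStrictFDerivAt_of_hasFDerivAt_of_continuousAt (f' := D) (.of_forall fun a => ?_)
    hD.continuousAt
  rw [hasFDerivAt_iff_isLittleO, Asymptotics.isLittleO_iff]
  intro c hc
  obtain ⟨δ, hδ, hball⟩ := Metric.continuousAt_iff.1 (hD.continuousAt (x := a)) c hc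
  filter_upwards [Metric.ball_mem_nhds a hδ] with b hb
  have hcont : Continuous fun t : ℝ => D (a + t • (b - a)) (b - a) := by fun_prop
  have hconst : D a (b - a) = ∫ _ in (0 : ℝ)..1, D a (b - a) := by simp
  rw [hg, hconst, ← intervalIntegral.integral_sub (hcont.intervalIntegrable _ _) (by simp)]
  have := intervalIntegral.norm_integral_le_of_norm_le_const (a := (0 : ℝ)) (b := 1)
    (C := c * ‖b - a‖) (f := fun t => D (a + t • (b - a)) (b - a) - D a (b - a)) fun t ht => by
      rw [Set.uIoc_of_le zero_le_one] at ht
      rw [← sub_apply]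
      refine (ContinuousLinearMap.le_opNorm _ _).trans ?_
      gcongr
      rw [← dist_eq_norm]
      refine (hball ?_).le
      rw [dist_eq_norm, add_sub_cancel_left, norm_smul, Real.norm_of_nonneg ht.1.le]
      rw [Metric.mem_ball, dist_eq_norm] at hb
      exact (mul_le_of_le_one_left (norm_nonneg _) ht.2).trans_lt hb
  simpa using this

theorem integrable_smulRight_translate {E V : Type*} [NormedAddCommGroup E]
    [NormedSpace ℝ E] [MeasurableSpace E] [BorelSpace E] {μ : Measure E} [μ.IsAddHaarMeasure]
    [NormedAddCommGroup V] [NormedSpace ℝ V] {f : E → ℝ} {φ : E → V} {M : ℝ}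
    (hφ : AEStronglyMeasurable φ μ) (hM : ∀ u, ‖φ u‖ ≤ M)
    (hf' : Integrable (fderiv ℝ f) μ) (x : E) :
    Integrable (fun u => (fderiv ℝ f (u - x)).smulRight (φ u)) μ := by
  have h1 := hf'.comp_sub_right x
  refine (h1.norm.mul_const M).mono' ?_ (.of_forall fun u => ?_)
  · exact (ContinuousLinearMap.smulRightL ℝ E V).aestronglyMeasurable_comp₂
      h1.aestronglyMeasurable hφ
  · rw [ContinuousLinearMap.norm_smulRight_apply]
    gcongr
    exact hM u

section TranslationCalculus

variable {E V : Type*} [NormedAddCommGroup E] [NormedSpace ℝ E] [FiniteDimensional ℝ E]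
  [MeasurableSpace E] [BorelSpace E] {μ : Measure E} [μ.IsAddHaarMeasure]
  [NormedAddCommGroup V]

/-- Translation is continuous in `L¹`. -/
theorem tendsto_integral_norm_translate_sub {g : E → V} (hg : Integrable g μ) (b : E) :
    Tendsto (fun a => ∫ u, ‖g (u - a) - g (u - b)‖ ∂μ) (𝓝 b) (𝓝 0) := by
  have hg' : MemLp g 1 μ := memLp_one_iff_integrable.2 hg
  let T : E → C(E, E) := fun a => ⟨fun u => u - a, by fun_prop⟩
  have hT : ∀ a, MeasurePreserving (T a) μ μ := fun a => measurePreserving_sub_right μ a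
  have hTc : Continuous T := ContinuousMap.continuous_of_continuous_uncurry _ (by
    simp only [T, Function.uncurry_def, ContinuousMap.coe_mk]; fun_prop)
  have key : Tendsto (fun a => Lp.compMeasurePreserving (T a) (hT a) (hg'.toLp g)) (𝓝 b)
      (𝓝 (Lp.compMeasurePreserving (T b) (hT b) (hg'.toLp g))) :=
    tendsto_const_nhds.compMeasurePreservingLp hTc.continuousAt hT (hT b) (by simp)
  rw [tendsto_iff_dist_tendsto_zero] at key
  refine key.congr fun a => ?_
  rw [L1.dist_eq_integral_dist]
  refine integral_congr_ae ?_
  rw [Lp.toLp_compMeasurePreserving, Lp.toLp_compMeasurePreserving]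
  filter_upwards [MemLp.coeFn_toLp (hg'.comp_measurePreserving (hT a)),
    MemLp.coeFn_toLp (hg'.comp_measurePreserving (hT b))] with u h1 h2
  rw [h1, h2, dist_eq_norm]
  rfl

theorem integrable_prod_translate_segment {g : E → V} (hgm : StronglyMeasurable g)
    (hg : Integrable g μ) (a h : E) :
    Integrable (fun p : E × ℝ => g (p.1 - (a + p.2 • h)))
      (μ.prod (volume.restrict (Set.Ioc (0 : ℝ) 1))) := by
  rw [integrable_prod_iff']
  · refine ⟨.of_forall fun t => hg.comp_sub_right (a + t • h), ?_⟩
    have : (fun t : ℝ => ∫ u, ‖g (u - (a + t • h))‖ ∂μ) = fun _ => ∫ u, ‖g u‖ ∂μ := by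
      funext t
      exact integral_sub_right_eq_self (fun u => ‖g u‖) _
    simp only [this]
    exact integrable_const _
  · exact (hgm.comp_measurable (by fun_prop)).aestronglyMeasurable

variable [NormedSpace ℝ V] {f : E → ℝ}

/-- The fundamental theorem of calculus on the segment from `u - a` to `u - b`. No continuity of
the derivative is assumed, so its integrability on the segment has to come from Fubini's theorem,
and the formula is only claimed for almost every `u`. -/
theorem ae_translate_sub_eq_intervalIntegral (hf : Differentiable ℝ f)
    (hf' : Integrable (fderiv ℝ f) μ) (a b : E) :
    ∀ᵐ u ∂μ, f (u - b) - f (u - a) =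
      -∫ t in (0 : ℝ)..1, fderiv ℝ f (u - (a + t • (b - a))) (b - a) := by
  have hint := integrable_prod_translate_segment (measurable_fderiv ℝ f).stronglyMeasurable
    hf' a (b - a)
  filter_upwards [hint.prod_right_ae] with u hu
  have hu' : IntervalIntegrable (fun t : ℝ => fderiv ℝ f (u - (a + t • (b - a)))) volume 0 1 := by
    rw [intervalIntegrable_iff_integrableOn_Ioc_of_le zero_le_one]
    exact hu
  have hd : ∀ t : ℝ, HasDerivAt (fun t : ℝ => f (u - (a + t • (b - a))))
      (-(fderiv ℝ f (u - (a + t • (b - a))) (b - a))) t := by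
    intro t
    have h1 : HasDerivAt (fun t : ℝ => u - (a + t • (b - a))) (-((1 : ℝ) • (b - a))) t :=
      (((hasDerivAt_id t).smul_const (b - a)).const_add a).const_sub u
    have := (hf (u - (a + t • (b - a)))).hasFDerivAt.comp_hasDerivAt t h1
    rw [one_smul, map_neg] at this
    exact this
  have hi : IntervalIntegrable (fun t : ℝ => -(fderiv ℝ f (u - (a + t • (b - a))) (b - a)))
      volume 0 1 :=
    by
    rw [intervalIntegrable_iff_integrableOn_Ioc_of_le zero_le_one] at hu' ⊢
    exact ((ContinuousLinearMap.apply ℝ ℝ (b - a)).integrable_comp hu').neg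
  have := intervalIntegral.integral_eq_sub_of_hasDerivAt (fun t _ => hd t) hi
  rw [intervalIntegral.integral_neg] at this
  rw [this]
  simp

theorem integral_translate_smul_sub [CompleteSpace V] {φ : E → V} {M : ℝ}
    (hφ : AEStronglyMeasurable φ μ) (hM : ∀ u, ‖φ u‖ ≤ M)
    (hf : Differentiable ℝ f) (hfi : Integrable f μ) (hf' : Integrable (fderiv ℝ f) μ) (a b : E) :
    ∫ u, f (u - b) • φ u ∂μ - ∫ u, f (u - a) • φ u ∂μ =
      -∫ t in (0 : ℝ)..1,
        (∫ u, (fderiv ℝ f (u - (a + t • (b - a)))).smulRight (φ u) ∂μ) (b - a) := by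
  have hs : ∀ x, Integrable (fun u => f (u - x) • φ u) μ := fun x =>
    (hfi.comp_sub_right x).smul_bdd M hφ (.of_forall hM)
  have hint := integrable_prod_translate_segment (measurable_fderiv ℝ f).stronglyMeasurable
    hf' a (b - a)
  have hprod : Integrable (Function.uncurry fun (u : E) (t : ℝ) =>
      (fderiv ℝ f (u - (a + t • (b - a))) (b - a)) • φ u)
      (μ.prod (volume.restrict (Set.Ioc (0 : ℝ) 1))) :=
    ((ContinuousLinearMap.apply ℝ ℝ (b - a)).integrable_comp hint).smul_bdd M
      hφ.comp_fst (.of_forall fun p => hM p.1)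
  rw [← integral_sub (hs b) (hs a)]
  calc ∫ u, (f (u - b) • φ u - f (u - a) • φ u) ∂μ
      = ∫ u, -(∫ t in Set.Ioc (0 : ℝ) 1,
          (fderiv ℝ f (u - (a + t • (b - a))) (b - a)) • φ u) ∂μ := by
        refine integral_congr_ae ?_
        filter_upwards [ae_translate_sub_eq_intervalIntegral (μ := μ) hf hf' a b] with u hu
        rw [← sub_smul, hu, intervalIntegral.integral_of_le zero_le_one, neg_smul,
          integral_smul_const]
    _ = -∫ t in Set.Ioc (0 : ℝ) 1, ∫ u,
          (fderiv ℝ f (u - (a + t • (b - a))) (b - a)) • φ u ∂μ := by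
        rw [integral_neg, integral_integral_swap hprod]
    _ = _ := by
        rw [intervalIntegral.integral_of_le zero_le_one]
        congr 2 with t
        rw [ContinuousLinearMap.integral_apply (integrable_smulRight_translate hφ hM hf' _)]
        rfl

theorem continuous_integral_smulRight_translate {φ : E → V} {M : ℝ}
    (hφ : AEStronglyMeasurable φ μ) (hM : ∀ u, ‖φ u‖ ≤ M)
    (hf' : Integrable (fderiv ℝ f) μ) :
    Continuous fun x => ∫ u, (fderiv ℝ f (u - x)).smulRight (φ u) ∂μ := by
  refine continuous_iff_continuousAt.2 fun b => ?_
  rw [ContinuousAt, tendsto_iff_norm_sub_tendsto_zero]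
  have h0 := (tendsto_integral_norm_translate_sub hf' b).mul_const M
  rw [zero_mul] at h0
  refine squeeze_zero (fun _ => norm_nonneg _) (fun x => ?_) h0
  rw [← integral_sub (integrable_smulRight_translate hφ hM hf' x)
    (integrable_smulRight_translate hφ hM hf' b), ← integral_mul_const]
  have hi := ((hf'.comp_sub_right x).sub (hf'.comp_sub_right b)).norm.mul_const M
  refine norm_integral_le_of_norm_le hi (.of_forall fun u => ?_)
  have : (fderiv ℝ f (u - x)).smulRight (φ u) - (fderiv ℝ f (u - b)).smulRight (φ u) =
      (fderiv ℝ f (u - x) - fderiv ℝ f (u - b)).smulRight (φ u) := by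
    ext v; simp [sub_smul]
  rw [this, ContinuousLinearMap.norm_smulRight_apply]
  gcongr
  exact hM u

/-- Differentiation of `x ↦ ∫ f (u - x) • φ u`, where `φ` is merely bounded and measurable: the
derivative falls on `f`, which has to be differentiable with integrable, possibly discontinuous,
derivative. The continuity of the resulting derivative in `x` is the `L¹`-continuity of
translations. -/
theorem hasStrictFDerivAt_integral_translate_smul [CompleteSpace V] {φ : E → V} {M : ℝ}
    (hφ : AEStronglyMeasurable φ μ) (hM : ∀ u, ‖φ u‖ ≤ M)
    (hf : Differentiable ℝ f) (hfi : Integrable f μ) (hf' : Integrable (fderiv ℝ f) μ) (x : E) :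
    HasStrictFDerivAt (fun x => ∫ u, f (u - x) • φ u ∂μ)
      (-∫ u, (fderiv ℝ f (u - x)).smulRight (φ u) ∂μ) x := by
  refine hasStrictFDerivAt_of_sub_eq_intervalIntegral
    (D := fun x => -∫ u, (fderiv ℝ f (u - x)).smulRight (φ u) ∂μ)
    (continuous_integral_smulRight_translate hφ hM hf').neg (fun a b => ?_) x
  rw [integral_translate_smul_sub hφ hM hf hfi hf', ← intervalIntegral.integral_neg]
  rfl

end TranslationCalculus

namespace PerturbedModel

/-! ### Linear maximization over the polytope -/

section Polytope

variable {d : ℕ}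

/-- The directions in which `v` is the strict maximizer over `Y`. For `v ∈ Y` this is the interior
of the normal cone of the polytope at `v` if `v` is a vertex, and it is empty otherwise. -/
def strictCone (Y : Finset (EuclideanSpace ℝ (Fin d))) (v : EuclideanSpace ℝ (Fin d)) :
    Set (EuclideanSpace ℝ (Fin d)) :=
  {θ | ∀ y ∈ Y, y ≠ v → (inner ℝ y θ : ℝ) < inner ℝ v θ}

/-- The directions in which linear maximization over the polytope has a unique solution. -/
def IsGeneric (Y : Finset (EuclideanSpace ℝ (Fin d))) (θ : EuclideanSpace ℝ (Fin d)) :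
    Prop :=
  ∃ v ∈ Y, θ ∈ strictCone Y v

variable {Y : Finset (EuclideanSpace ℝ (Fin d))} {v θ : EuclideanSpace ℝ (Fin d)}

theorem isOpen_strictCone (Y : Finset (EuclideanSpace ℝ (Fin d))) (v : EuclideanSpace ℝ (Fin d)) :
    IsOpen (strictCone Y v) := by
  have : strictCone Y v = ⋂ y ∈ Y, {θ | y ≠ v → (inner ℝ y θ : ℝ) < inner ℝ v θ} := by
    ext θ; simp [strictCone]
  rw [this]
  refine isOpen_biInter_finset fun y _ => ?_
  by_cases h : y = v
  · simp [h]
  · simp only [ne_eq, h, not_false_eq_true, forall_true_left]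
    exact isOpen_lt (by fun_prop) (by fun_prop)

theorem mem_polytope (hv : v ∈ Y) : v ∈ polytope Y := subset_convexHull ℝ _ hv

theorem inner_le_of_mem_polytope {c : ℝ} (h : ∀ y ∈ Y, (inner ℝ y θ : ℝ) ≤ c)
    {y : EuclideanSpace ℝ (Fin d)} (hy : y ∈ polytope Y) : (inner ℝ y θ : ℝ) ≤ c := by
  have hc : Convex ℝ {y : EuclideanSpace ℝ (Fin d) | (inner ℝ y θ : ℝ) ≤ c} := by
    simp_rw [real_inner_comm]
    exact convex_halfSpace_le (innerSL ℝ θ).toLinearMap.isLinear c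
  exact convexHull_min (fun y hy => h y hy) hc hy

theorem inner_le_of_mem_strictCone (hθ : θ ∈ strictCone Y v) {y : EuclideanSpace ℝ (Fin d)}
    (hy : y ∈ polytope Y) : (inner ℝ y θ : ℝ) ≤ inner ℝ v θ := by
  refine inner_le_of_mem_polytope (fun y hy => ?_) hy
  by_cases h : y = v
  · rw [h]
  · exact (hθ y hy h).le

theorem eq_of_mem_strictCone (hθ : θ ∈ strictCone Y v) {y : EuclideanSpace ℝ (Fin d)}
    (hy : y ∈ polytope Y) (hle : (inner ℝ v θ : ℝ) ≤ inner ℝ y θ) : y = v := by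
  obtain ⟨w, hw0, hw1, rfl⟩ := Finset.mem_convexHull'.1 hy
  have hz : ∀ i ∈ Y, 0 ≤ w i * (inner ℝ v θ - inner ℝ i θ) := fun i hi =>
    mul_nonneg (hw0 i hi) (sub_nonneg.2 (inner_le_of_mem_strictCone hθ (mem_polytope hi)))
  have hsum : ∑ i ∈ Y, w i * ((inner ℝ v θ : ℝ) - inner ℝ i θ) = 0 := by
    refine le_antisymm ?_ (Finset.sum_nonneg hz)
    simp_rw [mul_sub]
    rw [Finset.sum_sub_distrib, ← Finset.sum_mul, hw1, one_mul]
    simp_rw [sum_inner, real_inner_smul_left] at hle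
    linarith
  rw [Finset.sum_eq_zero_iff_of_nonneg hz] at hsum
  have : ∀ i ∈ Y, w i • i = w i • v := fun i hi => by
    by_cases h : i = v
    · rw [h]
    · rcases mul_eq_zero.1 (hsum i hi) with h0 | h0
      · simp [h0]
      · exact absurd (hθ i hi h) (by linarith)
  rw [Finset.sum_congr rfl this, ← Finset.sum_smul, hw1, one_smul]

theorem maximizer_eq_of_mem_strictCone (hv : v ∈ Y) (hθ : θ ∈ strictCone Y v) :
    maximizer Y θ = v := by
  have h : ∃! y, y ∈ polytope Y ∧ ∀ y' ∈ polytope Y, (inner ℝ y' θ : ℝ) ≤ inner ℝ y θ :=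
    ⟨v, ⟨mem_polytope hv, fun y' hy' => inner_le_of_mem_strictCone hθ hy'⟩,
      fun y hy => eq_of_mem_strictCone hθ hy.1 (hy.2 v (mem_polytope hv))⟩
  rw [maximizer, dif_pos h]
  exact eq_of_mem_strictCone hθ h.choose_spec.1.1 (h.choose_spec.1.2 v (mem_polytope hv))

theorem exists_vertex_maximal (hY : Y.Nonempty) (θ : EuclideanSpace ℝ (Fin d)) :
    ∃ v ∈ Y, ∀ y ∈ polytope Y, (inner ℝ y θ : ℝ) ≤ inner ℝ v θ := by
  obtain ⟨v, hv, h⟩ := Y.exists_max_image (fun y => (inner ℝ y θ : ℝ)) hY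
  exact ⟨v, hv, fun y hy => inner_le_of_mem_polytope h hy⟩

/-- A unique maximizer over the polytope is a point of `Y` and a strict maximizer over `Y`, so the
convention for the other directions applies exactly off the generic ones. -/
theorem maximizer_eq_zero_of_not_isGeneric (hY : Y.Nonempty) (h : ¬ IsGeneric Y θ) :
    maximizer Y θ = 0 := by
  rw [maximizer, dif_neg]
  rintro ⟨v, ⟨-, -⟩, huniq⟩
  obtain ⟨u, hu, humax⟩ := exists_vertex_maximal hY θ
  refine h ⟨u, hu, fun y hy hne => lt_of_not_ge fun hle => hne ?_⟩
  rw [huniq y ⟨mem_polytope hy, fun y' hy' => (humax y' hy').trans hle⟩,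
    huniq u ⟨mem_polytope hu, humax⟩]

theorem maximizer_eq_sum_indicator (hY : Y.Nonempty) :
    maximizer Y = fun θ => ∑ v ∈ Y, (strictCone Y v).indicator (fun _ => v) θ := by
  funext θ
  by_cases h : IsGeneric Y θ
  · obtain ⟨v, hv, hθ⟩ := h
    rw [maximizer_eq_of_mem_strictCone hv hθ, Finset.sum_eq_single v, Set.indicator_of_mem hθ]
    · intro u hu hne
      refine Set.indicator_of_notMem (fun hu' => ?_) _
      exact lt_asymm (hθ u hu hne) (hu' v hv hne.symm)
    · exact fun h => absurd hv h
  · rw [maximizer_eq_zero_of_not_isGeneric hY h, Finset.sum_eq_zero]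
    exact fun v hv => Set.indicator_of_notMem (fun hθ => h ⟨v, hv, hθ⟩) _

theorem measurable_maximizer (hY : Y.Nonempty) : Measurable (maximizer Y) := by
  rw [maximizer_eq_sum_indicator hY]
  exact Finset.measurable_sum _ fun v _ =>
    measurable_const.indicator (isOpen_strictCone Y v).measurableSet

theorem exists_norm_le (Y : Finset (EuclideanSpace ℝ (Fin d))) :
    ∃ M : ℝ, 0 ≤ M ∧ ∀ y ∈ Y, ‖y‖ ≤ M :=
  ⟨∑ y ∈ Y, ‖y‖, Finset.sum_nonneg fun _ _ => norm_nonneg _,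
    fun _ hy => Finset.single_le_sum (f := fun y => ‖y‖) (fun _ _ => norm_nonneg _) hy⟩

theorem norm_maximizer_le (hY : Y.Nonempty) {M : ℝ} (hM0 : 0 ≤ M) (hM : ∀ y ∈ Y, ‖y‖ ≤ M)
    (θ : EuclideanSpace ℝ (Fin d)) : ‖maximizer Y θ‖ ≤ M := by
  by_cases h : IsGeneric Y θ
  · obtain ⟨v, hv, hθ⟩ := h
    rw [maximizer_eq_of_mem_strictCone hv hθ]
    exact hM v hv
  · rw [maximizer_eq_zero_of_not_isGeneric hY h, norm_zero]
    exact hM0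

theorem IsGeneric.maximizer_mem (h : IsGeneric Y θ) : maximizer Y θ ∈ polytope Y := by
  obtain ⟨v, hv, hθ⟩ := h
  rw [maximizer_eq_of_mem_strictCone hv hθ]
  exact mem_polytope hv

theorem IsGeneric.inner_le (h : IsGeneric Y θ) {y : EuclideanSpace ℝ (Fin d)}
    (hy : y ∈ polytope Y) : (inner ℝ y θ : ℝ) ≤ inner ℝ (maximizer Y θ) θ := by
  obtain ⟨v, hv, hθ⟩ := h
  rw [maximizer_eq_of_mem_strictCone hv hθ]
  exact inner_le_of_mem_strictCone hθ hy

/-- Off the finitely many hyperplanes orthogonal to the differences of points of `Y`, every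
direction is generic. -/
theorem ae_isGeneric (hY : Y.Nonempty) : ∀ᵐ θ : EuclideanSpace ℝ (Fin d), IsGeneric Y θ := by
  have h : ∀ u ∈ Y, ∀ v ∈ Y, ∀ᵐ θ : EuclideanSpace ℝ (Fin d),
      u ≠ v → (inner ℝ u θ : ℝ) ≠ inner ℝ v θ := by
    intro u _ v _
    by_cases huv : u = v
    · simp [huv]
    have hs : (LinearMap.ker (innerSL ℝ (u - v)).toLinearMap) ≠ ⊤ := by
      intro ht
      have : u - v ∈ LinearMap.ker (innerSL ℝ (u - v)).toLinearMap := by rw [ht]; trivial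
      rw [LinearMap.mem_ker] at this
      exact huv (sub_eq_zero.1 (inner_self_eq_zero.1 this))
    have := Measure.addHaar_submodule (volume : Measure (EuclideanSpace ℝ (Fin d))) _ hs
    filter_upwards [compl_mem_ae_iff.2 this] with θ hθ _ heq
    refine hθ ?_
    simp [heq]
  have h' : ∀ᵐ θ : EuclideanSpace ℝ (Fin d), ∀ u ∈ Y, ∀ v ∈ Y,
      u ≠ v → (inner ℝ u θ : ℝ) ≠ inner ℝ v θ := by
    refine (ae_ball_iff Y.countable_toSet).2 fun u hu => ?_
    exact (ae_ball_iff Y.countable_toSet).2 fun v hv => h u hu v hv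
  filter_upwards [h'] with θ hθ
  obtain ⟨v, hv, hmax⟩ := exists_vertex_maximal hY θ
  exact ⟨v, hv, fun y hy hne => lt_of_le_of_ne (hmax y (mem_polytope hy)) (hθ y hy v hv hne)⟩

theorem ae_isGeneric_add_smul (hY : Y.Nonempty) (θ : EuclideanSpace ℝ (Fin d)) {ε : ℝ}
    (hε : ε ≠ 0) :
    ∀ᵐ z : EuclideanSpace ℝ (Fin d), IsGeneric Y (θ + ε • z) := by
  have h1 : ∀ᵐ z : EuclideanSpace ℝ (Fin d), IsGeneric Y (θ + z) :=
    (measurePreserving_add_left (volume : Measure (EuclideanSpace ℝ (Fin d))) 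
      θ).quasiMeasurePreserving.ae (ae_isGeneric hY)
  exact (Measure.quasiMeasurePreserving_smul (volume : Measure (EuclideanSpace ℝ (Fin d))) hε).ae h1

theorem inner_le_maxValue {y : EuclideanSpace ℝ (Fin d)} (hy : y ∈ polytope Y)
    (θ : EuclideanSpace ℝ (Fin d)) : (inner ℝ y θ : ℝ) ≤ maxValue Y θ := by
  have hY : Y.Nonempty := by
    rw [← Finset.coe_nonempty, ← convexHull_nonempty_iff (𝕜 := ℝ)]
    exact ⟨y, hy⟩
  obtain ⟨v, hv, hmax⟩ := exists_vertex_maximal hY θ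
  refine le_csSup ⟨inner ℝ v θ, ?_⟩ ⟨y, hy, rfl⟩
  rintro _ ⟨u, hu, rfl⟩
  exact hmax u hu

theorem exists_maxValue_eq (hY : Y.Nonempty) (θ : EuclideanSpace ℝ (Fin d)) :
    ∃ v ∈ Y, maxValue Y θ = inner ℝ v θ := by
  obtain ⟨v, hv, hmax⟩ := exists_vertex_maximal hY θ
  refine ⟨v, hv, le_antisymm ?_ (inner_le_maxValue (mem_polytope hv) θ)⟩
  refine csSup_le ⟨_, v, mem_polytope hv, rfl⟩ ?_
  rintro _ ⟨u, hu, rfl⟩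
  exact hmax u hu

theorem convexOn_maxValue (hY : Y.Nonempty) : ConvexOn ℝ Set.univ (maxValue Y) := by
  refine ⟨convex_univ, fun x _ y _ a b ha hb _ => ?_⟩
  obtain ⟨v, hv, h⟩ := exists_maxValue_eq hY (a • x + b • y)
  rw [h, inner_add_right, real_inner_smul_right, real_inner_smul_right]
  have h1 := inner_le_maxValue (mem_polytope hv) x
  have h2 := inner_le_maxValue (mem_polytope hv) y
  simp only [smul_eq_mul]
  gcongr

theorem maxValue_sub_le (hY : Y.Nonempty) {M : ℝ} (hM : ∀ y ∈ Y, ‖y‖ ≤ M)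
    (x y : EuclideanSpace ℝ (Fin d)) :
    maxValue Y x - maxValue Y y ≤ M * ‖x - y‖ := by
  obtain ⟨v, hv, h⟩ := exists_maxValue_eq hY x
  have h1 := inner_le_maxValue (mem_polytope hv) y
  calc maxValue Y x - maxValue Y y ≤ inner ℝ v x - inner ℝ v y := by linarith
    _ = inner ℝ v (x - y) := (inner_sub_right _ _ _).symm
    _ ≤ ‖v‖ * ‖x - y‖ := real_inner_le_norm _ _
    _ ≤ M * ‖x - y‖ := by gcongr; exact hM v hv

theorem abs_maxValue_sub_le (hY : Y.Nonempty) {M : ℝ} (hM : ∀ y ∈ Y, ‖y‖ ≤ M)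
    (x y : EuclideanSpace ℝ (Fin d)) :
    |maxValue Y x - maxValue Y y| ≤ M * ‖x - y‖ := by
  rw [abs_sub_le_iff]
  refine ⟨maxValue_sub_le hY hM x y, ?_⟩
  rw [norm_sub_rev]
  exact maxValue_sub_le hY hM y x

theorem continuous_maxValue (hY : Y.Nonempty) : Continuous (maxValue Y) := by
  obtain ⟨M, hM0, hM⟩ := exists_norm_le Y
  refine (LipschitzWith.of_dist_le_mul (K := M.toNNReal) fun x y => ?_).continuous
  rw [Real.dist_eq, dist_eq_norm, Real.coe_toNNReal M hM0]
  exact abs_maxValue_sub_le hY hM x y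

theorem maxValue_eq_of_mem_strictCone (hv : v ∈ Y) (hθ : θ ∈ strictCone Y v) :
    maxValue Y θ = inner ℝ v θ := by
  obtain ⟨u, hu, h⟩ := exists_maxValue_eq ⟨v, hv⟩ θ
  refine le_antisymm ?_ (inner_le_maxValue (mem_polytope hv) θ)
  rw [h]
  exact inner_le_of_mem_strictCone hθ (mem_polytope hu)

theorem IsGeneric.hasFDerivAt_maxValue (h : IsGeneric Y θ) :
    HasFDerivAt (maxValue Y) (innerSL ℝ (maximizer Y θ)) θ := by
  obtain ⟨v, hv, hθ⟩ := h
  rw [maximizer_eq_of_mem_strictCone hv hθ]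
  refine (innerSL ℝ v).hasFDerivAt.congr_of_eventuallyEq ?_
  filter_upwards [(isOpen_strictCone Y v).mem_nhds hθ] with x hx
  exact maxValue_eq_of_mem_strictCone hv hx

end Polytope

/-! ### Differentiability of the perturbed maximum and of the perturbed maximizer -/

section Perturbed

variable {d : ℕ}

/-- The normalized density `exp (-ν) / ∫ exp (-ν)` of the noise. -/
noncomputable def noiseDensity (ν : EuclideanSpace ℝ (Fin d) → ℝ) (z : EuclideanSpace ℝ (Fin d)) :
    ℝ :=
  Real.exp (-ν z) / ∫ x, Real.exp (-ν x)

variable {Y : Finset (EuclideanSpace ℝ (Fin d))} {ν : EuclideanSpace ℝ (Fin d) → ℝ} {ε : ℝ}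

theorem isProbabilityMeasure_noise (hdens : Integrable (fun z => Real.exp (-ν z)) volume) :
    IsProbabilityMeasure (noise ν) :=
  isProbabilityMeasure_tilted hdens

theorem noiseDensity_pos (hdens : Integrable (fun z => Real.exp (-ν z)) volume)
    (z : EuclideanSpace ℝ (Fin d)) : 0 < noiseDensity ν z :=
  div_pos (Real.exp_pos _) (integral_exp_pos hdens)

theorem integrable_noiseDensity (hdens : Integrable (fun z => Real.exp (-ν z)) volume) :
    Integrable (noiseDensity ν) :=
  hdens.div_const _

theorem differentiable_noiseDensity (hν : Differentiable ℝ ν) :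
    Differentiable ℝ (noiseDensity ν) := by
  unfold noiseDensity
  fun_prop

theorem integrable_fderiv_noiseDensity (hν : Differentiable ℝ ν)
    (hdens : Integrable (fun z => Real.exp (-ν z)) volume)
    (hgrad : Integrable (gradient ν) (noise ν)) :
    Integrable (fderiv ℝ (noiseDensity ν)) := by
  have h1 : Integrable (fun z => Real.exp (-ν z) • gradient ν z) :=
    (integrable_tilted_iff hdens (gradient ν)).1 hgrad
  refine (h1.norm.div_const (∫ x, Real.exp (-ν x))).mono'
    (measurable_fderiv ℝ _).aestronglyMeasurable (.of_forall fun z => ?_)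
  have h2 : HasFDerivAt (noiseDensity ν)
      ((∫ x, Real.exp (-ν x))⁻¹ • Real.exp (-ν z) • -fderiv ℝ ν z) z := by
    have := ((hν z).hasFDerivAt.neg.exp).const_mul (∫ x, Real.exp (-ν x))⁻¹
    refine this.congr_of_eventuallyEq (.of_forall fun x => ?_)
    simp [noiseDensity, div_eq_inv_mul]
  rw [h2.fderiv, norm_smul, norm_smul, norm_smul, norm_neg, gradient,
    LinearIsometryEquiv.norm_map, norm_inv, Real.norm_of_nonneg (integral_exp_pos hdens).le,
    div_eq_inv_mul]

theorem ae_noise_isGeneric (hY : Y.Nonempty) (ν : EuclideanSpace ℝ (Fin d) → ℝ) (hε : ε ≠ 0)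
    (θ : EuclideanSpace ℝ (Fin d)) : ∀ᵐ z ∂(noise ν), IsGeneric Y (θ + ε • z) :=
  (tilted_absolutelyContinuous _ _).ae_le (ae_isGeneric_add_smul hY θ hε)

theorem measurable_maximizer_add_smul (hY : Y.Nonempty) (ε : ℝ) (θ : EuclideanSpace ℝ (Fin d)) :
    Measurable fun z => maximizer Y (θ + ε • z) :=
  (measurable_maximizer hY).comp (by fun_prop)

theorem integrable_maximizer (hY : Y.Nonempty)
    (hdens : Integrable (fun z => Real.exp (-ν z)) volume) (ε : ℝ)
    (θ : EuclideanSpace ℝ (Fin d)) :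
    Integrable (fun z => maximizer Y (θ + ε • z)) (noise ν) := by
  have := isProbabilityMeasure_noise hdens
  obtain ⟨M, hM0, hM⟩ := exists_norm_le Y
  exact .of_bound (measurable_maximizer_add_smul hY ε θ).aestronglyMeasurable M
    (.of_forall fun z => norm_maximizer_le hY hM0 hM _)

theorem integrable_maxValue (hY : Y.Nonempty)
    (hdens : Integrable (fun z => Real.exp (-ν z)) volume)
    (hZ : Integrable (fun z => z) (noise ν)) (ε : ℝ) (θ : EuclideanSpace ℝ (Fin d)) :
    Integrable (fun z => maxValue Y (θ + ε • z)) (noise ν) := by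
  have := isProbabilityMeasure_noise hdens
  obtain ⟨M, hM0, hM⟩ := exists_norm_le Y
  refine ((((integrable_const θ).add (hZ.smul ε)).norm.const_mul M).add
    (integrable_const |maxValue Y 0|)).mono'
    ((continuous_maxValue hY).measurable.comp (by fun_prop)).aestronglyMeasurable
    (.of_forall fun z => ?_)
  have h := abs_maxValue_sub_le hY hM (θ + ε • z) 0
  rw [sub_zero] at h
  have h2 := abs_sub_abs_le_abs_sub (maxValue Y (θ + ε • z)) (maxValue Y 0)
  simp only [Real.norm_eq_abs, Pi.add_apply, Pi.smul_apply]
  linarith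

theorem hasGradientAt_perturbedMax (hY : Y.Nonempty)
    (hdens : Integrable (fun z => Real.exp (-ν z)) volume)
    (hZ : Integrable (fun z => z) (noise ν)) (hε : ε ≠ 0) (θ : EuclideanSpace ℝ (Fin d)) :
    HasGradientAt (perturbedMax Y ν ε) (perturbedMaximizer Y ν ε θ) θ := by
  have := isProbabilityMeasure_noise hdens
  obtain ⟨M, hM0, hM⟩ := exists_norm_le Y
  have hm := integrable_maximizer hY hdens ε θ
  have key := (hasFDerivAt_integral_of_dominated_loc_of_lip (μ := noise ν) (𝕜 := ℝ)
    (F := fun θ z => maxValue Y (θ + ε • z)) (x₀ := θ) (s := Set.univ) (bound := fun _ => M)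
    (F' := fun z => innerSL ℝ (maximizer Y (θ + ε • z))) univ_mem
    (.of_forall fun θ => (integrable_maxValue hY hdens hZ ε θ).aestronglyMeasurable)
    (integrable_maxValue hY hdens hZ ε θ)
    ((innerSL ℝ).continuous.comp_aestronglyMeasurable hm.aestronglyMeasurable)
    (.of_forall fun z => ?_) (integrable_const M) ?_).2
  · rw [hasGradientAt_iff_hasFDerivAt]
    have h2 := (innerSL ℝ).integral_comp_comm hm
    rw [h2] at key
    exact key
  · refine LipschitzWith.lipschitzOnWith (LipschitzWith.of_dist_le_mul fun x y => ?_)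
    rw [Real.dist_eq, dist_eq_norm, Real.coe_nnabs, abs_of_nonneg hM0]
    have := abs_maxValue_sub_le hY hM (x + ε • z) (y + ε • z)
    rwa [add_sub_add_right_eq_sub] at this
  · filter_upwards [ae_noise_isGeneric hY ν hε θ] with z hz
    exact (hasFDerivAt_comp_add_right _).2 hz.hasFDerivAt_maxValue

theorem convexOn_perturbedMax (hY : Y.Nonempty)
    (hdens : Integrable (fun z => Real.exp (-ν z)) volume)
    (hZ : Integrable (fun z => z) (noise ν)) (ε : ℝ) :
    ConvexOn ℝ Set.univ (perturbedMax Y ν ε) := by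
  refine ⟨convex_univ, fun x _ y _ a b ha hb hab => ?_⟩
  have hi := integrable_maxValue hY hdens hZ ε
  rw [perturbedMax, perturbedMax, perturbedMax, smul_eq_mul, smul_eq_mul, ← integral_const_mul,
    ← integral_const_mul, ← integral_add ((hi x).const_mul a) ((hi y).const_mul b)]
  refine integral_mono (hi _) (((hi x).const_mul a).add ((hi y).const_mul b)) fun z => ?_
  have := (convexOn_maxValue hY).2 (Set.mem_univ (x + ε • z)) (Set.mem_univ (y + ε • z)) ha hb hab
  have he : a • x + b • y + ε • z = a • (x + ε • z) + b • (y + ε • z) := by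
    have : ε • z = (a + b) • (ε • z) := by rw [hab, one_smul]
    rw [smul_add, smul_add]
    nth_rewrite 1 [this]
    rw [add_smul]
    abel
  simp only [he]
  exact this

theorem perturbedMaximizer_eq_integral (Y : Finset (EuclideanSpace ℝ (Fin d)))
    (ν : EuclideanSpace ℝ (Fin d) → ℝ) (ε : ℝ) (θ : EuclideanSpace ℝ (Fin d)) :
    perturbedMaximizer Y ν ε θ = ∫ z, noiseDensity ν z • maximizer Y (θ + ε • z) :=
  integral_tilted _ _

/-- The substitution `u = z + θ / ε` moves the parameter from the discontinuous maximizer to the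
density of the noise. -/
theorem exists_hasStrictFDerivAt_perturbedMaximizer (hY : Y.Nonempty) (hν : Differentiable ℝ ν)
    (hdens : Integrable (fun z => Real.exp (-ν z)) volume)
    (hgrad : Integrable (gradient ν) (noise ν)) (hε : ε ≠ 0) (θ : EuclideanSpace ℝ (Fin d)) :
    ∃ D : EuclideanSpace ℝ (Fin d) →L[ℝ] EuclideanSpace ℝ (Fin d),
      HasStrictFDerivAt (perturbedMaximizer Y ν ε) D θ := by
  obtain ⟨M, hM0, hM⟩ := exists_norm_le Y
  have h1 := hasStrictFDerivAt_integral_translate_smul (μ := volume) (f := noiseDensity ν)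
    (φ := fun u => maximizer Y (ε • u)) (M := M)
    ((measurable_maximizer hY).comp (g := maximizer Y)
      (f := fun u : EuclideanSpace ℝ (Fin d) => ε • u) (by fun_prop)).aestronglyMeasurable
    (fun u => norm_maximizer_le hY hM0 hM _) (differentiable_noiseDensity hν)
    (integrable_noiseDensity hdens) (integrable_fderiv_noiseDensity hν hdens hgrad) (ε⁻¹ • θ)
  have h2 : perturbedMaximizer Y ν ε = fun θ =>
      ∫ u, noiseDensity ν (u - ε⁻¹ • θ) • maximizer Y (ε • u) := by
    funext θ
    rw [perturbedMaximizer_eq_integral,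
      ← integral_sub_right_eq_self (fun z => noiseDensity ν z • maximizer Y (θ + ε • z)) (ε⁻¹ • θ)]
    refine integral_congr_ae (.of_forall fun u => ?_)
    simp only
    rw [smul_sub, smul_inv_smul₀ hε, add_sub_cancel]
  rw [h2]
  have h3 : HasStrictFDerivAt (fun θ : EuclideanSpace ℝ (Fin d) => ε⁻¹ • θ)
      (ε⁻¹ • ContinuousLinearMap.id ℝ _) θ := (hasStrictFDerivAt_id θ).const_smul ε⁻¹
  exact ⟨_, h1.comp θ h3⟩

end Perturbed

/-! ### Strict monotonicity of the perturbed maximizer -/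

section Monotone

variable {d : ℕ} {Y : Finset (EuclideanSpace ℝ (Fin d))} {ν : EuclideanSpace ℝ (Fin d) → ℝ}
  {ε : ℝ}

theorem nonempty_of_interior_polytope (hY : (interior (polytope Y)).Nonempty) : Y.Nonempty := by
  rw [← Finset.coe_nonempty, ← convexHull_nonempty_iff (𝕜 := ℝ)]
  exact hY.mono interior_subset

theorem exists_inner_lt_of_interior_polytope (hY : (interior (polytope Y)).Nonempty)
    {h : EuclideanSpace ℝ (Fin d)} (hh : h ≠ 0) :
    ∃ a ∈ polytope Y, ∃ b ∈ polytope Y, (inner ℝ b h : ℝ) < inner ℝ a h := by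
  obtain ⟨c, hc⟩ := hY
  have ht : Tendsto (fun t : ℝ => c + t • h) (𝓝[>] 0) (𝓝 c) := by
    have : Continuous fun t : ℝ => c + t • h := by fun_prop
    simpa using (this.tendsto 0).mono_left nhdsWithin_le_nhds
  have hev := (ht.eventually (isOpen_interior.mem_nhds hc)).and self_mem_nhdsWithin
  obtain ⟨t, ht1, ht2⟩ := hev.exists
  refine ⟨c + t • h, interior_subset ht1, c, interior_subset hc, ?_⟩
  rw [inner_add_left, real_inner_smul_left]
  have : 0 < t * inner ℝ h h := mul_pos ht2 (real_inner_self_pos.2 hh)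
  linarith

/-- Monotonicity of the maximizer, a selection of the subdifferential of a convex function. -/
theorem IsGeneric.inner_maximizer_le {x v : EuclideanSpace ℝ (Fin d)} {t : ℝ} (ht : 0 < t)
    (hx : IsGeneric Y x) (hxv : IsGeneric Y (x + t • v)) :
    (inner ℝ (maximizer Y x) v : ℝ) ≤ inner ℝ (maximizer Y (x + t • v)) v := by
  have h1 := hx.inner_le hxv.maximizer_mem
  have h2 := hxv.inner_le hx.maximizer_mem
  rw [inner_add_right, inner_add_right, real_inner_smul_right, real_inner_smul_right] at h2
  exact le_of_mul_le_mul_left (by linarith) ht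

/-- Far away in the directions `h` and `-h`, uniformly for base points `x` in a ball, the
maximizers almost realize the maximum and the minimum of `⟨·, h⟩` over the polytope, which differ
because the polytope has interior points. -/
theorem exists_gap_inner_maximizer (hY : (interior (polytope Y)).Nonempty)
    {h : EuclideanSpace ℝ (Fin d)} (hh : h ≠ 0) (R : ℝ) (hR : 0 ≤ R) :
    ∃ K : ℕ, 0 < K ∧ ∃ w > 0, ∀ x : EuclideanSpace ℝ (Fin d), ‖x‖ ≤ R →
      IsGeneric Y (x + (K : ℝ) • h) → IsGeneric Y (x - (K : ℝ) • h) →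
      w ≤ (inner ℝ (maximizer Y (x + (K : ℝ) • h)) h : ℝ) -
        inner ℝ (maximizer Y (x - (K : ℝ) • h)) h := by
  obtain ⟨a, ha, b, hb, hab⟩ := exists_inner_lt_of_interior_polytope hY hh
  obtain ⟨M, hM0, hM⟩ := exists_norm_le Y
  have hYn := nonempty_of_interior_polytope hY
  set w : ℝ := inner ℝ a h - inner ℝ b h with hw
  have hw0 : 0 < w := sub_pos.2 hab
  set L : ℝ := (‖a‖ + ‖b‖ + 2 * M) * R with hL
  -- testing optimality against `a` and `b` costs at most `L / K`, to be less than half of `w`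
  obtain ⟨K, hK⟩ := exists_nat_gt (2 * L / w)
  have hL0 : 0 ≤ L := by positivity
  have hK0 : (0 : ℝ) < K := lt_of_le_of_lt (by positivity) hK
  refine ⟨K, by exact_mod_cast hK0, w / 2, by positivity, fun x hx hp hm => ?_⟩
  have e1 := hp.inner_le ha
  have e2 := hm.inner_le hb
  rw [inner_add_right, inner_add_right, real_inner_smul_right, real_inner_smul_right] at e1
  rw [inner_sub_right, inner_sub_right, real_inner_smul_right, real_inner_smul_right] at e2
  have bd : ∀ u : EuclideanSpace ℝ (Fin d), |(inner ℝ u x : ℝ)| ≤ ‖u‖ * R := fun u =>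
    (abs_real_inner_le_norm u x).trans (by gcongr)
  have f1 := (abs_le.1 (bd a)).1
  have f2 := (abs_le.1 (bd b)).1
  have f3 := (abs_le.1 (bd (maximizer Y (x + (K : ℝ) • h)))).2
  have f4 := (abs_le.1 (bd (maximizer Y (x - (K : ℝ) • h)))).2
  have g3 : ‖maximizer Y (x + (K : ℝ) • h)‖ * R ≤ M * R := by
    gcongr; exact norm_maximizer_le hYn hM0 hM _
  have g4 : ‖maximizer Y (x - (K : ℝ) • h)‖ * R ≤ M * R := by
    gcongr; exact norm_maximizer_le hYn hM0 hM _
  rw [div_lt_iff₀ hw0] at hK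
  refine le_of_mul_le_mul_left ?_ hK0
  have : L = ‖a‖ * R + ‖b‖ * R + 2 * (M * R) := by rw [hL]; ring
  have : (K : ℝ) * w = K * inner ℝ a h - K * inner ℝ b h := by rw [hw]; ring
  rw [mul_sub]
  linarith

theorem integrable_noiseDensity_mul (hY : Y.Nonempty)
    (hdens : Integrable (fun z => Real.exp (-ν z)) volume) (ε : ℝ)
    (θ h : EuclideanSpace ℝ (Fin d)) :
    Integrable fun z => noiseDensity ν z * inner ℝ (maximizer Y (θ + ε • z)) h := by
  obtain ⟨M, hM0, hM⟩ := exists_norm_le Y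
  refine (integrable_noiseDensity hdens).mul_bdd (c := M * ‖h‖) ?_ (.of_forall fun z => ?_)
  · exact ((measurable_maximizer_add_smul hY ε θ).inner_const).aestronglyMeasurable
  · refine (norm_inner_le_norm _ _).trans ?_
    gcongr
    exact norm_maximizer_le hY hM0 hM _

theorem inner_perturbedMaximizer (hY : Y.Nonempty)
    (hdens : Integrable (fun z => Real.exp (-ν z)) volume) (ε : ℝ)
    (θ h : EuclideanSpace ℝ (Fin d)) :
    (inner ℝ (perturbedMaximizer Y ν ε θ) h : ℝ) =
      ∫ z, noiseDensity ν z * inner ℝ (maximizer Y (θ + ε • z)) h := by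
  obtain ⟨M, hM0, hM⟩ := exists_norm_le Y
  rw [perturbedMaximizer_eq_integral, real_inner_comm, ← integral_inner]
  · simp_rw [real_inner_smul_right, real_inner_comm h]
  · exact (integrable_noiseDensity hdens).smul_bdd M
      (measurable_maximizer_add_smul hY ε θ).aestronglyMeasurable
      (.of_forall fun z => norm_maximizer_le hY hM0 hM _)

/-- An increment of the perturbed maximizer, with the variable of integration shifted by an
arbitrary vector `ε⁻¹ • s`. -/
theorem inner_perturbedMaximizer_sub (hY : Y.Nonempty)
    (hdens : Integrable (fun z => Real.exp (-ν z)) volume) (hε : ε ≠ 0)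
    (θ h v s : EuclideanSpace ℝ (Fin d)) :
    (inner ℝ (perturbedMaximizer Y ν ε (θ + v) - perturbedMaximizer Y ν ε θ) h : ℝ) =
      ∫ z, noiseDensity ν (z + ε⁻¹ • s) *
        (inner ℝ (maximizer Y (θ + ε • z + (s + v))) h -
          inner ℝ (maximizer Y (θ + ε • z + s)) h) := by
  rw [inner_sub_left, inner_perturbedMaximizer hY hdens, inner_perturbedMaximizer hY hdens,
    ← integral_sub (integrable_noiseDensity_mul hY hdens ε _ h)
      (integrable_noiseDensity_mul hY hdens ε _ h),
    ← integral_add_right_eq_self _ (ε⁻¹ • s)]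
  refine integral_congr_ae (.of_forall fun z => ?_)
  simp only [smul_add, smul_inv_smul₀ hε]
  have e1 : θ + v + (ε • z + s) = θ + ε • z + (s + v) := by abel
  have e2 : θ + (ε • z + s) = θ + ε • z + s := by abel
  rw [mul_sub, e1, e2]

/-- A lower bound, linear in the step, for the increments of the perturbed maximizer along `h`.
Write the increment with step `h / N` as an integral in as many ways as there are steps on the
segment from `-K h` to `K h`. The integrands are nonnegative, so each integral is bounded below by
the density's minimum times an integral over a fixed ball, and the sum of these telescopes to a
quantity which is positive by `exists_gap_inner_maximizer` and independent of `N`. The case `N =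
1` gives injectivity, the limit `N → ∞` gives positivity of the derivative. -/
theorem exists_le_inner_perturbedMaximizer_sub (hY : (interior (polytope Y)).Nonempty)
    (hν : Differentiable ℝ ν) (hdens : Integrable (fun z => Real.exp (-ν z)) volume)
    (hε : 0 < ε) (θ : EuclideanSpace ℝ (Fin d)) {h : EuclideanSpace ℝ (Fin d)} (hh : h ≠ 0) :
    ∃ c > 0, ∀ N : ℕ, 0 < N →
      c ≤ N * (inner ℝ (perturbedMaximizer Y ν ε (θ + (N : ℝ)⁻¹ • h) -
        perturbedMaximizer Y ν ε θ) h : ℝ) := by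
  have hYn := nonempty_of_interior_polytope hY
  obtain ⟨K, hK0, w, hw0, hgap⟩ :=
    exists_gap_inner_maximizer hY hh (‖θ‖ + ε) (by positivity)
  set B := Metric.closedBall (0 : EuclideanSpace ℝ (Fin d)) 1
  -- this ball contains all translates of `B` along `s k` that occur below
  obtain ⟨z₀, -, hz₀⟩ := (isCompact_closedBall (0 : EuclideanSpace ℝ (Fin d))
    (1 + ε⁻¹ * (K * ‖h‖))).exists_isMinOn (Metric.nonempty_closedBall.2 (by positivity))
    (differentiable_noiseDensity hν).continuous.continuousOn
  set m := noiseDensity ν z₀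
  have hm0 : 0 < m := noiseDensity_pos hdens z₀
  have hB0 : 0 < volume.real B :=
    ENNReal.toReal_pos (Metric.measure_closedBall_pos volume _ one_pos).ne'
      measure_closedBall_lt_top.ne
  refine ⟨m * (volume.real B * w) / (2 * K), by positivity, fun N hN => ?_⟩
  have hN0 : (0 : ℝ) < N := by exact_mod_cast hN
  set v : EuclideanSpace ℝ (Fin d) := (N : ℝ)⁻¹ • h with hv
  let s : ℕ → EuclideanSpace ℝ (Fin d) := fun k => (-(K : ℝ) + k * (N : ℝ)⁻¹) • h
  have hs : ∀ k, s (k + 1) = s k + v := fun k => by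
    simp only [s, hv, ← add_smul]; push_cast; ring_nf
  let q : ℕ → EuclideanSpace ℝ (Fin d) → ℝ := fun k z =>
    inner ℝ (maximizer Y (θ + ε • z + s k)) h
  obtain ⟨M, hM0, hM⟩ := exists_norm_le Y
  have hgen : ∀ k, ∀ᵐ z : EuclideanSpace ℝ (Fin d), IsGeneric Y (θ + ε • z + s k) := fun k => by
    filter_upwards [ae_isGeneric_add_smul hYn (θ + s k) hε.ne'] with z hz
    rwa [add_right_comm] at hz
  have hqint : ∀ k, IntegrableOn (q k) B := fun k => by
    have hmeas : Measurable (q k) :=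
      ((measurable_maximizer hYn).comp (by fun_prop)).inner_const
    refine Measure.integrableOn_of_bounded measure_closedBall_lt_top.ne
      hmeas.aestronglyMeasurable (M := M * ‖h‖) (.of_forall fun z => ?_)
    refine (norm_inner_le_norm _ _).trans ?_
    gcongr
    exact norm_maximizer_le hYn hM0 hM _
  set D : ℝ := inner ℝ (perturbedMaximizer Y ν ε (θ + v) - perturbedMaximizer Y ν ε θ) h
  have hstep : ∀ k ∈ Finset.range (2 * K * N), m * ∫ z in B, (q (k + 1) z - q k z) ≤ D := by
    intro k hk
    have hDk : D = ∫ z, noiseDensity ν (z + ε⁻¹ • s k) * (q (k + 1) z - q k z) := by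
      simp only [q, hs]
      exact inner_perturbedMaximizer_sub hYn hdens hε.ne' θ h v (s k)
    have hnn : ∀ᵐ z : EuclideanSpace ℝ (Fin d), 0 ≤ q (k + 1) z - q k z := by
      filter_upwards [hgen k, hgen (k + 1)] with z h1 h2
      simp only [q, hs, ← add_assoc] at h2 ⊢
      exact sub_nonneg.2 (h1.inner_maximizer_le (inv_pos.2 hN0) h2)
    have hsk : ‖s k‖ ≤ K * ‖h‖ := by
      simp only [s, norm_smul, Real.norm_eq_abs]
      gcongr
      have hk' : (k : ℝ) * (N : ℝ)⁻¹ ≤ 2 * K := by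
        rw [mul_inv_le_iff₀ hN0]
        exact_mod_cast (Finset.mem_range.1 hk).le
      have : 0 ≤ (k : ℝ) * (N : ℝ)⁻¹ := by positivity
      exact abs_le.2 ⟨by linarith, by linarith⟩
    have hint : Integrable fun z => noiseDensity ν (z + ε⁻¹ • s k) * (q (k + 1) z - q k z) := by
      refine ((integrable_noiseDensity hdens).comp_add_right (ε⁻¹ • s k)).mul_bdd
        (c := M * ‖h‖ + M * ‖h‖) ?_ (.of_forall fun z => ?_)
      · exact ((((measurable_maximizer hYn).comp (by fun_prop)).inner_const).sub
          (((measurable_maximizer hYn).comp (by fun_prop)).inner_const)).aestronglyMeasurable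
      · refine (norm_sub_le _ _).trans ?_
        refine add_le_add ((norm_inner_le_norm _ _).trans ?_) ((norm_inner_le_norm _ _).trans ?_)
        all_goals
          gcongr
          exact norm_maximizer_le hYn hM0 hM _
    rw [hDk, ← integral_const_mul]
    refine le_trans ?_ (setIntegral_le_integral (s := B) hint ?_)
    · refine setIntegral_mono_on_ae (((hqint (k + 1)).sub (hqint k)).const_mul m)
        hint.integrableOn measurableSet_closedBall ?_
      filter_upwards [hnn] with z hz hzB
      refine mul_le_mul_of_nonneg_right (hz₀ ?_) hz
      rw [mem_closedBall_zero_iff] at hzB ⊢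
      refine (norm_add_le _ _).trans ?_
      rw [norm_smul, norm_inv, Real.norm_of_nonneg hε.le]
      gcongr
    · filter_upwards [hnn] with z hz
      exact mul_nonneg (noiseDensity_pos hdens _).le hz
  have hsum := Finset.sum_le_sum hstep
  rw [← Finset.mul_sum, ← integral_finsetSum (Finset.range (2 * K * N))
    (f := fun k z => q (k + 1) z - q k z) (fun k _ => (hqint (k + 1)).sub (hqint k))] at hsum
  simp only [fun z => Finset.sum_range_sub (fun k => q k z), Finset.sum_const, Finset.card_range,
    nsmul_eq_mul] at hsum
  have hlow : volume.real B * w ≤ ∫ z in B, (q (2 * K * N) z - q 0 z) := by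
    have hc : volume.real B * w = ∫ _ in B, w := by simp [mul_comm]
    rw [hc]
    refine setIntegral_mono_on_ae (integrableOn_const measure_closedBall_lt_top.ne)
      ((hqint _).sub (hqint _)) measurableSet_closedBall ?_
    have hend : s (2 * K * N) = (K : ℝ) • h := by
      simp only [s]; congr 1; push_cast; field_simp; ring
    have h0 : s 0 = -((K : ℝ) • h) := by simp [s]
    filter_upwards [hgen (2 * K * N), hgen 0] with z h1 h2 hzB
    simp only [q]
    rw [hend] at h1 ⊢
    rw [h0, ← sub_eq_add_neg] at h2 ⊢
    refine hgap _ ?_ h1 h2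
    rw [mem_closedBall_zero_iff] at hzB
    refine (norm_add_le _ _).trans ?_
    rw [norm_smul, Real.norm_of_nonneg hε.le]
    gcongr
    exact mul_le_of_le_one_right hε.le hzB
  have hK0' : (0 : ℝ) < K := by exact_mod_cast hK0
  rw [div_le_iff₀ (by positivity)]
  have := (mul_le_mul_of_nonneg_left hlow hm0.le).trans hsum
  push_cast at this
  linarith

theorem perturbedMaximizer_injective (hY : (interior (polytope Y)).Nonempty)
    (hν : Differentiable ℝ ν) (hdens : Integrable (fun z => Real.exp (-ν z)) volume)
    (hε : 0 < ε) : Function.Injective (perturbedMaximizer Y ν ε) := by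
  intro x y hxy
  by_contra hne
  obtain ⟨c, hc, H⟩ := exists_le_inner_perturbedMaximizer_sub hY hν hdens hε x
    (sub_ne_zero.2 (Ne.symm hne))
  have := H 1 one_pos
  simp [hxy] at this
  linarith

theorem inner_fderiv_perturbedMaximizer_pos (hY : (interior (polytope Y)).Nonempty)
    (hν : Differentiable ℝ ν) (hdens : Integrable (fun z => Real.exp (-ν z)) volume)
    (hε : 0 < ε) {θ : EuclideanSpace ℝ (Fin d)}
    {D : EuclideanSpace ℝ (Fin d) →L[ℝ] EuclideanSpace ℝ (Fin d)}
    (hD : HasFDerivAt (perturbedMaximizer Y ν ε) D θ)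
    {h : EuclideanSpace ℝ (Fin d)} (hh : h ≠ 0) : 0 < (inner ℝ (D h) h : ℝ) := by
  obtain ⟨c, hc, H⟩ := exists_le_inner_perturbedMaximizer_sub hY hν hdens hε θ hh
  refine hc.trans_le ?_
  have hlim := hD.lim h (c := fun n : ℕ => (n : ℝ)) (l := atTop)
    (by simpa using tendsto_natCast_atTop_atTop)
  refine ge_of_tendsto (hlim.inner tendsto_const_nhds) ?_
  filter_upwards [eventually_gt_atTop 0] with n hn
  rw [real_inner_smul_left]
  exact H n hn

end Monotone

/-! ### Covariance matrices and Gaussian vectors -/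

section Gaussian

variable {d : ℕ}

theorem multivariateGaussian_zero_map_toEuclideanCLM {S : Matrix (Fin d) (Fin d) ℝ}
    (hS : S.PosSemidef) (A : Matrix (Fin d) (Fin d) ℝ) :
    (multivariateGaussian 0 S).map (Matrix.toEuclideanCLM (𝕜 := ℝ) A) =
      multivariateGaussian 0 (A * S * A.transpose) := by
  have hS' : (A * S * A.transpose).PosSemidef := by
    have := hS.mul_mul_conjTranspose_same A
    rwa [Matrix.conjTranspose_eq_transpose_of_trivial] at this
  have : IsProbabilityMeasure
      ((multivariateGaussian 0 S).map (Matrix.toEuclideanCLM (𝕜 := ℝ) A)) :=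
    Measure.isProbabilityMeasure_map (by fun_prop)
  refine Measure.ext_of_charFun (funext fun t => ?_)
  have h1 : charFun ((multivariateGaussian 0 S).map (Matrix.toEuclideanCLM (𝕜 := ℝ) A)) t =
      charFun (multivariateGaussian 0 S) (Matrix.toEuclideanCLM (𝕜 := ℝ) A.transpose t) := by
    rw [charFun_apply, charFun_apply, integral_map (by fun_prop)
      (Measurable.aestronglyMeasurable (by fun_prop))]
    congr 1 with x
    rw [Matrix.inner_toEuclideanCLM, real_inner_comm, Matrix.inner_toEuclideanCLM,
      Matrix.mulVec_transpose, Matrix.dotProduct_mulVec, dotProduct_comm]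
  rw [h1, charFun_multivariateGaussian hS, charFun_multivariateGaussian hS']
  simp only [inner_zero_right, Matrix.ofLp_toEuclideanCLM]
  congr 4
  rw [Matrix.mulVec_transpose, ← Matrix.dotProduct_mulVec, Matrix.mulVec_mulVec,
    ← Matrix.mulVec_transpose, Matrix.mulVec_mulVec]

variable {p : Measure (EuclideanSpace ℝ (Fin d))} [IsProbabilityMeasure p]

theorem covarianceBilin_eq_dotProduct_covarianceMatrix (hp : MemLp id 2 p)
    (x y : EuclideanSpace ℝ (Fin d)) :
    covarianceBilin p x y = x.ofLp ⬝ᵥ (covarianceMatrix p).mulVec y.ofLp := by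
  have hX : ∀ i, MemLp (fun z : EuclideanSpace ℝ (Fin d) => z i) 2 p := fun i => hp.eval_piLp i
  have := covarianceBilin_apply_pi hX x y
  rw [show (fun ω : EuclideanSpace ℝ (Fin d) => WithLp.toLp 2 fun i => ω i) = id from rfl,
    Measure.map_id] at this
  rw [this]
  simp only [dotProduct, Matrix.mulVec, covarianceMatrix, Matrix.of_apply, Finset.mul_sum]
  exact Finset.sum_congr rfl fun i _ => Finset.sum_congr rfl fun j _ => by ring

theorem dotProduct_covarianceMatrix_eq_variance (hp : MemLp id 2 p)
    (x : EuclideanSpace ℝ (Fin d)) :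
    x.ofLp ⬝ᵥ (covarianceMatrix p).mulVec x.ofLp = Var[fun z => inner ℝ x z; p] := by
  rw [← covarianceBilin_eq_dotProduct_covarianceMatrix hp, covarianceBilin_self hp]

theorem posSemidef_covarianceMatrix (hp : MemLp id 2 p) : (covarianceMatrix p).PosSemidef := by
  refine Matrix.PosSemidef.of_dotProduct_mulVec_nonneg ?_ fun x => ?_
  · ext i j
    simp [covarianceMatrix, covariance_comm]
  · have := dotProduct_covarianceMatrix_eq_variance hp (WithLp.toLp 2 x)
    simp only [star_trivial]
    rw [this]
    exact variance_nonneg _ _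

end Gaussian

/-! ### The multivariate central limit theorem and the delta method -/

section Limit

theorem aemeasurable_sampleMean {d : ℕ} {Ω : Type*} [MeasurableSpace Ω] {P : Measure Ω}
    {y : ℕ → Ω → EuclideanSpace ℝ (Fin d)}
    (hy : ∀ i, AEMeasurable (y i) P) (n : ℕ) :
    AEMeasurable (fun ω => sampleMean (fun i => y i ω) n) P := by
  unfold sampleMean
  fun_prop

variable {d : ℕ} {Ω : Type*} [MeasurableSpace Ω] {P : Measure Ω} [IsProbabilityMeasure P]

/-- The central limit theorem in `ℝ^d`, obtained from the one-dimensional theorem applied to the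
projections on all directions and from Lévy's convergence theorem. -/
theorem tendstoInDistribution_sqrt_smul_sampleMean_sub
    {p : Measure (EuclideanSpace ℝ (Fin d))} [IsProbabilityMeasure p] (hp : MemLp id 2 p)
    {y : ℕ → Ω → EuclideanSpace ℝ (Fin d)} (hindep : iIndepFun y P)
    (hlaw : ∀ i, HasLaw (y i) p P) :
    TendstoInDistribution
      (fun (n : ℕ) ω => √(n : ℝ) • (sampleMean (fun i => y i ω) n - ∫ x, x ∂p)) atTop id
      (fun _ => P) (multivariateGaussian 0 (covarianceMatrix p)) where
  forall_aemeasurable n := by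
    have := aemeasurable_sampleMean (fun i => (hlaw i).aemeasurable) n
    fun_prop
  tendsto := by
    refine ProbabilityMeasure.tendsto_iff_tendsto_charFun.2 fun t => ?_
    simp only [ProbabilityMeasure.coe_mk, Measure.map_id]
    have hid : ∀ i, IdentDistrib (fun ω => (inner ℝ t (y i ω) : ℝ))
        (fun ω => inner ℝ t (y 0 ω)) P P := fun i =>
      IdentDistrib.comp (u := fun x => (inner ℝ t x : ℝ))
        ⟨(hlaw i).aemeasurable, (hlaw 0).aemeasurable, by rw [(hlaw i).map_eq, (hlaw 0).map_eq]⟩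
        (by fun_prop)
    have hL2 : MemLp (fun ω => (inner ℝ t (y 0 ω) : ℝ)) 2 P := by
      have h0 : MemLp (y 0) 2 P := by
        have h1 : MemLp id 2 (P.map (y 0)) := by rw [(hlaw 0).map_eq]; exact hp
        exact h1.comp_of_map (hlaw 0).aemeasurable
      exact h0.const_inner t
    have hvar : Var[fun ω => (inner ℝ t (y 0 ω) : ℝ); P] = Var[fun z => inner ℝ t z; p] := by
      rw [← (hlaw 0).map_eq, variance_map (by fun_prop) (hlaw 0).aemeasurable]
      rfl
    have hmean : P[fun ω => (inner ℝ t (y 0 ω) : ℝ)] = inner ℝ t (∫ x, x ∂p) := by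
      have h1 := (hlaw 0).integral_comp (f := fun x => (inner ℝ t x : ℝ))
        (by fun_prop)
      refine h1.trans (integral_inner (hp.integrable (by norm_num)) t)
    -- the one-dimensional central limit theorem for the projections on `t`
    have hclt := tendstoInDistribution_inv_sqrt_mul_sum_sub (P := P)
      (X := fun i ω => (inner ℝ t (y i ω) : ℝ)) (HasLaw.id) hL2
      (hindep.comp (fun _ x => (inner ℝ t x : ℝ)) fun _ => by fun_prop) hid
    have hchar := ProbabilityMeasure.tendsto_iff_tendsto_charFun.1 hclt.tendsto 1
    simp only [ProbabilityMeasure.coe_mk, Measure.map_id] at hchar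
    have hS := posSemidef_covarianceMatrix hp
    rw [charFun_multivariateGaussian hS, dotProduct_covarianceMatrix_eq_variance hp]
    rw [charFun_gaussianReal, hvar] at hchar
    have hlim : Complex.exp (inner ℝ t (0 : EuclideanSpace ℝ (Fin d)) * Complex.I
          - (Var[fun z => (inner ℝ t z : ℝ); p] : ℝ) / 2) =
        Complex.exp ((1 : ℝ) * (0 : ℝ) * Complex.I
          - (Var[fun z => (inner ℝ t z : ℝ); p].toNNReal : ℝ) * (1 : ℝ) ^ 2 / 2) := by
      rw [Real.coe_toNNReal _ (variance_nonneg _ _)]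
      simp
    rw [hlim]
    refine hchar.congr fun n => ?_
    have hm0 := aemeasurable_sampleMean (fun i => (hlaw i).aemeasurable) n
    have hm1 : AEMeasurable
        (fun ω => √(n : ℝ) • (sampleMean (fun i => y i ω) n - ∫ x, x ∂p)) P := by
      fun_prop
    have hm2 := hclt.forall_aemeasurable n
    rw [charFun_apply, charFun_apply, integral_map hm1
      (Measurable.aestronglyMeasurable (by fun_prop)), integral_map hm2
      (Measurable.aestronglyMeasurable (by fun_prop))]
    refine integral_congr_ae (.of_forall fun ω => ?_)
    simp only
    congr 3
    rw [hmean]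
    simp only [real_inner_comm t, inner_sub_right, real_inner_smul_right, sampleMean, inner_sum,
      RCLike.inner_apply, conj_trivial, one_mul]
    rcases Nat.eq_zero_or_pos n with rfl | hn
    · simp
    · have hs0 : √(n : ℝ) ≠ 0 := (Real.sqrt_pos.2 (by exact_mod_cast hn)).ne'
      have hs : (n : ℝ) = √(n : ℝ) ^ 2 := (Real.sq_sqrt n.cast_nonneg).symm
      generalize √(n : ℝ) = s at hs hs0 ⊢
      rw [hs]
      field_simp

/-- The delta method. The estimates `θ n` only have to agree with `ψ (X n)` almost surely for `n`
large, so no measurability of `ψ` is needed. -/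
theorem tendstoInDistribution_delta_method {γ : Measure (EuclideanSpace ℝ (Fin d))}
    [IsProbabilityMeasure γ] {X θ : ℕ → Ω → EuclideanSpace ℝ (Fin d)}
    {m : EuclideanSpace ℝ (Fin d)} {ψ : EuclideanSpace ℝ (Fin d) → EuclideanSpace ℝ (Fin d)}
    {A : EuclideanSpace ℝ (Fin d) →L[ℝ] EuclideanSpace ℝ (Fin d)} {r : ℕ → ℝ}
    (hψ : HasFDerivAt ψ A m) (hX : ∀ n, AEMeasurable (X n) P) (hθ : ∀ n, AEMeasurable (θ n) P)
    (hr : ∀ n, 0 ≤ r n)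
    (hXm : ∀ᵐ ω ∂P, Tendsto (fun n => X n ω) atTop (𝓝 m))
    (hθX : ∀ᵐ ω ∂P, ∀ᶠ n in atTop, θ n ω = ψ (X n ω))
    (hlim : TendstoInDistribution (fun n ω => r n • (X n ω - m)) atTop id (fun _ => P) γ) :
    TendstoInDistribution (fun n ω => r n • (θ n ω - ψ m)) atTop A (fun _ => P) γ := by
  -- the normalized remainder of the first-order expansion, which tends to zero almost surely
  let ρ : ℕ → Ω → EuclideanSpace ℝ (Fin d) := fun n ω =>
    ‖X n ω - m‖⁻¹ • (θ n ω - ψ m - A (X n ω - m))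
  have hρm : ∀ n, AEMeasurable (ρ n) P := fun n =>
    ((hX n).sub_const m).norm.inv.smul (((hθ n).sub_const _).sub
      (A.continuous.measurable.comp_aemeasurable ((hX n).sub_const m)))
  have hρ0 : ∀ᵐ ω ∂P, Tendsto (fun n => ρ n ω) atTop (𝓝 0) := by
    filter_upwards [hXm, hθX] with ω h1 h2
    rw [tendsto_zero_iff_norm_tendsto_zero]
    refine ((hasFDerivAt_iff_tendsto.1 hψ).comp h1).congr' ?_
    filter_upwards [h2] with n hn
    simp only [ρ, Function.comp_apply, norm_smul, norm_inv, norm_norm, hn]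
  have hmain := hlim.continuous_comp_prodMk_of_tendstoInMeasure_const
    (g := fun q : EuclideanSpace ℝ (Fin d) × EuclideanSpace ℝ (Fin d) => A q.1 + ‖q.1‖ • q.2)
    (by fun_prop) (tendstoInMeasure_of_tendsto_ae (fun n => (hρm n).aestronglyMeasurable) hρ0) hρm
  simp only [id, smul_zero, add_zero] at hmain
  have hθr : ∀ n, AEMeasurable (fun ω => r n • (θ n ω - ψ m)) P := fun n => by
    have := hθ n
    fun_prop
  refine tendstoInDistribution_of_tendstoInMeasure_sub _ _ hmain ?_ hθr
  refine tendstoInMeasure_of_tendsto_ae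
    (fun n => ((hθr n).sub (hmain.forall_aemeasurable n)).aestronglyMeasurable) ?_
  filter_upwards [hθX] with ω h
  refine tendsto_const_nhds.congr' ?_
  filter_upwards [h] with n hn
  simp only [Pi.zero_apply, Pi.sub_apply]
  -- where `X n ω = m` the normalization in `ρ` divides by zero, but then both sides vanish
  by_cases hXn : X n ω = m
  · simp [hn, hXn]
  · have h0 : ‖X n ω - m‖ ≠ 0 := norm_ne_zero_iff.2 (sub_ne_zero.2 hXn)
    simp only [ρ, norm_smul, Real.norm_of_nonneg (hr n), map_smul]
    rw [smul_smul, mul_assoc, mul_inv_cancel₀ h0, mul_one, smul_sub (r n) (θ n ω - ψ m)]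
    abel

end Limit

/-! ### The estimator -/

theorem isMinOn_univ_of_convexOn_of_hasFDerivAt_zero {E : Type*} [NormedAddCommGroup E]
    [NormedSpace ℝ E] {f : E → ℝ} (hf : ConvexOn ℝ Set.univ f) {x : E}
    (hx : HasFDerivAt f (0 : E →L[ℝ] ℝ) x) : IsMinOn f Set.univ x := by
  intro y _
  have hlim := hx.lim (y - x) (c := fun n : ℕ => (n : ℝ)) (l := atTop)
    (by simpa using tendsto_natCast_atTop_atTop)
  refine sub_nonneg.1 (le_of_tendsto hlim ?_)
  filter_upwards [eventually_gt_atTop 0] with n hn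
  have hn' : (0 : ℝ) < n := by exact_mod_cast hn
  have hn1 : (n : ℝ)⁻¹ ≤ 1 := inv_le_one_of_one_le₀ (by exact_mod_cast hn)
  have h := hf.2 (Set.mem_univ x) (Set.mem_univ y) (sub_nonneg.2 hn1) (inv_nonneg.2 hn'.le)
    (sub_add_cancel 1 _)
  have he : (1 - (n : ℝ)⁻¹) • x + (n : ℝ)⁻¹ • y = x + (n : ℝ)⁻¹ • (y - x) := by
    rw [sub_smul, one_smul, smul_sub]; abel
  rw [he, smul_eq_mul, smul_eq_mul] at h
  rw [smul_eq_mul, mul_comm, ← le_div_iff₀ hn', div_eq_mul_inv]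
  linarith

section Estimator

variable {d : ℕ} {Y : Finset (EuclideanSpace ℝ (Fin d))} {ν : EuclideanSpace ℝ (Fin d) → ℝ}
  {ε : ℝ}

theorem empiricalLoss_eq (Y : Finset (EuclideanSpace ℝ (Fin d)))
    (ν : EuclideanSpace ℝ (Fin d) → ℝ) (ε : ℝ) (y : ℕ → EuclideanSpace ℝ (Fin d)) {n : ℕ}
    (hn : 0 < n) (θ : EuclideanSpace ℝ (Fin d)) :
    empiricalLoss Y ν ε y n θ = perturbedMax Y ν ε θ - inner ℝ (sampleMean y n) θ +
      (n : ℝ)⁻¹ * ∑ i ∈ Finset.range n, ε * regularizer Y ν (y i) := by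
  have hn' : (n : ℝ) ≠ 0 := by exact_mod_cast hn.ne'
  simp only [empiricalLoss, fyLoss, sampleMean, Finset.sum_sub_distrib, Finset.sum_add_distrib,
    Finset.sum_const, Finset.card_range, nsmul_eq_mul, real_inner_comm θ, real_inner_smul_right,
    inner_sum]
  field_simp
  ring

/-- The empirical loss is a convex function of the parameter, with gradient `perturbedMaximizer Y
ν ε θ - sampleMean y n`. For `n = 0` the loss vanishes identically, and every parameter minimizes
it. -/
theorem isMinOn_empiricalLoss_iff (hY : Y.Nonempty)
    (hdens : Integrable (fun z => Real.exp (-ν z)) volume)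
    (hZ : Integrable (fun z => z) (noise ν)) (hε : ε ≠ 0) (y : ℕ → EuclideanSpace ℝ (Fin d))
    {n : ℕ} (hn : 0 < n) (θ : EuclideanSpace ℝ (Fin d)) :
    IsMinOn (empiricalLoss Y ν ε y n) Set.univ θ ↔
      perturbedMaximizer Y ν ε θ = sampleMean y n := by
  have hd : HasFDerivAt (empiricalLoss Y ν ε y n)
      (innerSL ℝ (perturbedMaximizer Y ν ε θ) - innerSL ℝ (sampleMean y n)) θ := by
    have h1 := (hasGradientAt_perturbedMax hY hdens hZ hε θ).hasFDerivAt
    have h2 := (h1.sub (innerSL ℝ (sampleMean y n)).hasFDerivAt).add_const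
      ((n : ℝ)⁻¹ * ∑ i ∈ Finset.range n, ε * regularizer Y ν (y i))
    exact h2.congr_of_eventuallyEq (.of_forall fun x => empiricalLoss_eq Y ν ε y hn x)
  constructor
  · intro h
    have h0 := (h.isLocalMin univ_mem).hasFDerivAt_eq_zero hd
    rw [← map_sub] at h0
    have := congrArg (fun L => L (perturbedMaximizer Y ν ε θ - sampleMean y n)) h0
    exact sub_eq_zero.1 (inner_self_eq_zero.1 this)
  · intro h
    rw [h, sub_self] at hd
    refine isMinOn_univ_of_convexOn_of_hasFDerivAt_zero ?_ hd
    have hc : empiricalLoss Y ν ε y n = fun x =>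
        (perturbedMax Y ν ε x + (-innerSL ℝ (sampleMean y n)) x) +
          (n : ℝ)⁻¹ * ∑ i ∈ Finset.range n, ε * regularizer Y ν (y i) := by
      funext x
      rw [empiricalLoss_eq Y ν ε y hn x, sub_eq_add_neg]
      rfl
    rw [hc]
    exact ((convexOn_perturbedMax hY hdens hZ ε).add
      ((-innerSL ℝ (sampleMean y n)).toLinearMap.convexOn convex_univ)).add_const _

theorem gradient_perturbedMax (hY : Y.Nonempty)
    (hdens : Integrable (fun z => Real.exp (-ν z)) volume)
    (hZ : Integrable (fun z => z) (noise ν)) (hε : ε ≠ 0) :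
    gradient (perturbedMax Y ν ε) = perturbedMaximizer Y ν ε :=
  funext fun θ => (hasGradientAt_perturbedMax hY hdens hZ hε θ).gradient

theorem inner_fderiv_perturbedMaximizer_comm (hY : Y.Nonempty)
    (hdens : Integrable (fun z => Real.exp (-ν z)) volume)
    (hZ : Integrable (fun z => z) (noise ν)) (hε : ε ≠ 0) {θ : EuclideanSpace ℝ (Fin d)}
    {D : EuclideanSpace ℝ (Fin d) →L[ℝ] EuclideanSpace ℝ (Fin d)}
    (hD : HasFDerivAt (perturbedMaximizer Y ν ε) D θ) (v w : EuclideanSpace ℝ (Fin d)) :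
    (inner ℝ (D v) w : ℝ) = inner ℝ (D w) v := by
  have h := second_derivative_symmetric (𝕜 := ℝ)
    (f' := fun x => innerSL ℝ (perturbedMaximizer Y ν ε x)) (f'' := (innerSL ℝ).comp D)
    (fun x => (hasGradientAt_perturbedMax hY hdens hZ hε x).hasFDerivAt)
    ((innerSL ℝ).hasFDerivAt.comp θ hD) v w
  exact h

theorem toEuclideanCLM_hessian {G : EuclideanSpace ℝ (Fin d) → ℝ} {θ : EuclideanSpace ℝ (Fin d)} :
    Matrix.toEuclideanCLM (𝕜 := ℝ) (hessian G θ) = fderiv ℝ (gradient G) θ := by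
  refine ContinuousLinearMap.coe_injective
    ((EuclideanSpace.basisFun (Fin d) ℝ).toBasis.ext fun j => ?_)
  ext i
  simp [hessian, Matrix.ofLp_toEuclideanCLM]

theorem isProbabilityMeasure_model (hY : Y.Nonempty)
    (hdens : Integrable (fun z => Real.exp (-ν z)) volume) (ε : ℝ)
    (θ : EuclideanSpace ℝ (Fin d)) : IsProbabilityMeasure (model Y ν ε θ) := by
  have := isProbabilityMeasure_noise hdens
  exact Measure.isProbabilityMeasure_map (measurable_maximizer_add_smul hY ε θ).aemeasurable

theorem memLp_id_model (hY : Y.Nonempty)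
    (hdens : Integrable (fun z => Real.exp (-ν z)) volume) (ε : ℝ)
    (θ : EuclideanSpace ℝ (Fin d)) : MemLp id 2 (model Y ν ε θ) := by
  have := isProbabilityMeasure_noise hdens
  obtain ⟨M, hM0, hM⟩ := exists_norm_le Y
  have hm := measurable_maximizer_add_smul hY ε θ
  rw [model, memLp_map_measure_iff aestronglyMeasurable_id hm.aemeasurable]
  exact .of_bound hm.aestronglyMeasurable M (.of_forall fun z => norm_maximizer_le hY hM0 hM _)

theorem integral_id_model (hY : Y.Nonempty) (ν : EuclideanSpace ℝ (Fin d) → ℝ) (ε : ℝ)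
    (θ : EuclideanSpace ℝ (Fin d)) :
    ∫ x, x ∂(model Y ν ε θ) = perturbedMaximizer Y ν ε θ := by
  rw [model, integral_map (measurable_maximizer_add_smul hY ε θ).aemeasurable
    (f := fun x => x) aestronglyMeasurable_id]
  rfl

theorem ae_tendsto_sampleMean {Ω : Type*} [MeasurableSpace Ω] {P : Measure Ω}
    {p : Measure (EuclideanSpace ℝ (Fin d))} (hp : Integrable id p)
    {y : ℕ → Ω → EuclideanSpace ℝ (Fin d)} (hindep : iIndepFun y P)
    (hlaw : ∀ i, HasLaw (y i) p P) :
    ∀ᵐ ω ∂P, Tendsto (fun n => sampleMean (fun i => y i ω) n) atTop (𝓝 (∫ x, x ∂p)) := by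
  have h := strong_law_ae y (μ := P) ?_ (fun i j hij => hindep.indepFun hij) fun i =>
    ⟨(hlaw i).aemeasurable, (hlaw 0).aemeasurable, by rw [(hlaw i).map_eq, (hlaw 0).map_eq]⟩
  · rwa [(hlaw 0).integral_eq] at h
  · have h1 : Integrable id (P.map (y 0)) := by rw [(hlaw 0).map_eq]; exact hp
    exact h1.comp_aemeasurable (hlaw 0).aemeasurable

end Estimator

end PerturbedModel

theorem proposition4 {d : ℕ} (Y : Finset (EuclideanSpace ℝ (Fin d)))
    (hY : (interior (PerturbedModel.polytope Y)).Nonempty)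
    -- the noise has the positive differentiable density proportional to `exp (-ν)`
    (ν : EuclideanSpace ℝ (Fin d) → ℝ) (hν : Differentiable ℝ ν)
    (hdens : Integrable (fun z => Real.exp (-ν z)) volume)
    -- `E ‖Z‖` and `E ‖∇ν(Z)‖` are finite
    (hZ : Integrable (fun z => z) (PerturbedModel.noise ν))
    (hgrad : Integrable (gradient ν) (PerturbedModel.noise ν))
    (ε : ℝ) (hε : 0 < ε) (θ₀ : EuclideanSpace ℝ (Fin d))
    -- i.i.d. observations with law `p_{θ₀}`
    {Ω : Type*} [MeasurableSpace Ω] (P : Measure Ω) [IsProbabilityMeasure P]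
    (y : ℕ → Ω → EuclideanSpace ℝ (Fin d)) (hindep : iIndepFun y P)
    (hlaw : ∀ i, HasLaw (y i) (PerturbedModel.model Y ν ε θ₀) P)
    -- the estimator minimizes the empirical loss whenever a minimizer exists
    (θhat : ℕ → Ω → EuclideanSpace ℝ (Fin d)) (hmeas : ∀ n, AEMeasurable (θhat n) P)
    (hmin : ∀ n, ∀ᵐ ω ∂P,
      (∃ θ, IsMinOn (PerturbedModel.empiricalLoss Y ν ε (fun i => y i ω) n) Set.univ θ) →
        IsMinOn (PerturbedModel.empiricalLoss Y ν ε (fun i => y i ω) n) Set.univ (θhat n ω)) :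
    -- almost surely, for `n` large, the estimator is a minimizer and solves the moment equation
    (∀ᵐ ω ∂P, ∀ᶠ n in atTop,
      IsMinOn (PerturbedModel.empiricalLoss Y ν ε (fun i => y i ω) n) Set.univ (θhat n ω) ∧
        PerturbedModel.perturbedMaximizer Y ν ε (θhat n ω) =
          PerturbedModel.sampleMean (fun i => y i ω) n) ∧
    -- the Hessian of `F_ε` at `θ₀` exists and is invertible
    Differentiable ℝ (PerturbedModel.perturbedMax Y ν ε) ∧
    DifferentiableAt ℝ (gradient (PerturbedModel.perturbedMax Y ν ε)) θ₀ ∧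
    IsUnit (PerturbedModel.hessian (PerturbedModel.perturbedMax Y ν ε) θ₀).det ∧
    -- asymptotic normality
    TendstoInDistribution (fun (n : ℕ) (ω : Ω) => √(n : ℝ) • (θhat n ω - θ₀)) atTop id
      (fun _ => P)
      (multivariateGaussian 0
        ((PerturbedModel.hessian (PerturbedModel.perturbedMax Y ν ε) θ₀)⁻¹ *
          PerturbedModel.covarianceMatrix (PerturbedModel.model Y ν ε θ₀) *
          (PerturbedModel.hessian (PerturbedModel.perturbedMax Y ν ε) θ₀)⁻¹)) := by
  open PerturbedModel in
  have hYn := nonempty_of_interior_polytope hY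
  have hgradF := gradient_perturbedMax hYn hdens hZ hε.ne'
  obtain ⟨D, hD⟩ :=
    exists_hasStrictFDerivAt_perturbedMaximizer hYn hν hdens hgrad hε.ne' θ₀
  set H := hessian (perturbedMax Y ν ε) θ₀ with hH
  have hHD : Matrix.toEuclideanCLM (𝕜 := ℝ) H = D := by
    rw [hH, toEuclideanCLM_hessian, hgradF, hD.hasFDerivAt.fderiv]
  have hpos : ∀ h, h ≠ 0 → 0 < (inner ℝ (D h) h : ℝ) := fun h hh =>
    inner_fderiv_perturbedMaximizer_pos hY hν hdens hε hD.hasFDerivAt hh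
  have hdet : IsUnit H.det := by
    rw [← Matrix.isUnit_iff_isUnit_det, ← Matrix.mulVec_injective_iff_isUnit]
    refine (injective_iff_map_eq_zero H.mulVecLin).2 fun v hv => ?_
    by_contra hne
    have h0 : D (WithLp.toLp 2 v) = 0 := by
      rw [← hHD, Matrix.toEuclideanCLM_toLp]
      exact congrArg (WithLp.toLp 2) hv
    have := hpos (WithLp.toLp 2 v) (by simpa using hne)
    simp [h0] at this
  have hsymm : H.transpose = H := by
    ext i j
    have h1 : ∀ i j, H i j =
        inner ℝ (D (EuclideanSpace.single j 1)) (EuclideanSpace.single i 1) := by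
      intro i j
      rw [← hHD]
      simp [EuclideanSpace.inner_single_right, Matrix.ofLp_toEuclideanCLM]
    rw [Matrix.transpose_apply, h1, h1]
    exact inner_fderiv_perturbedMaximizer_comm hYn hdens hZ hε.ne' hD.hasFDerivAt _ _
  -- the derivative of the perturbed maximizer as a linear equivalence
  have hl : ∀ A B : Matrix (Fin d) (Fin d) ℝ, A * B = 1 → Function.LeftInverse
      (Matrix.toEuclideanCLM (𝕜 := ℝ) A) (Matrix.toEuclideanCLM (𝕜 := ℝ) B) := by
    intro A B hAB v
    rw [← mul_apply_eq_comp, ← map_mul, hAB, map_one]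
    rfl
  let e : EuclideanSpace ℝ (Fin d) ≃L[ℝ] EuclideanSpace ℝ (Fin d) :=
    ContinuousLinearEquiv.equivOfInverse (Matrix.toEuclideanCLM (𝕜 := ℝ) H)
      (Matrix.toEuclideanCLM (𝕜 := ℝ) H⁻¹) (hl _ _ (Matrix.nonsing_inv_mul H hdet))
      (hl _ _ (Matrix.mul_nonsing_inv H hdet))
  have hDe : HasStrictFDerivAt (perturbedMaximizer Y ν ε)
      (e : EuclideanSpace ℝ (Fin d) →L[ℝ] EuclideanSpace ℝ (Fin d)) θ₀ := by
    have : (e : EuclideanSpace ℝ (Fin d) →L[ℝ] EuclideanSpace ℝ (Fin d)) = D := by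
      rw [← hHD]; rfl
    rwa [this]
  have hprob := isProbabilityMeasure_model hYn hdens ε θ₀
  have hL2 := memLp_id_model hYn hdens ε θ₀
  have hmean := integral_id_model hYn ν ε θ₀
  have hslln := ae_tendsto_sampleMean (hL2.integrable (by norm_num)) hindep hlaw
  rw [hmean] at hslln
  have hsol : ∀ᵐ ω ∂P, ∀ᶠ n in atTop,
      IsMinOn (empiricalLoss Y ν ε (fun i => y i ω) n) Set.univ (θhat n ω) ∧
        perturbedMaximizer Y ν ε (θhat n ω) = sampleMean (fun i => y i ω) n := by
    filter_upwards [hslln, ae_all_iff.2 hmin] with ω h1 h2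
    filter_upwards [h1.eventually hDe.eventually_right_inverse, eventually_gt_atTop 0] with n h3 hn
    have hiff := isMinOn_empiricalLoss_iff hYn hdens hZ hε.ne' (fun i => y i ω) hn
    have h4 := h2 n ⟨_, (hiff _).2 h3⟩
    exact ⟨h4, (hiff _).1 h4⟩
  refine ⟨hsol, fun θ => (hasGradientAt_perturbedMax hYn hdens hZ hε.ne' θ).differentiableAt, ?_,
    hdet, ?_⟩
  · rw [hgradF]
    exact hD.hasFDerivAt.differentiableAt
  · have hloc : ∀ᵐ ω ∂P, ∀ᶠ n in atTop,
        θhat n ω = hDe.localInverse _ _ _ (sampleMean (fun i => y i ω) n) := by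
      filter_upwards [hslln, hsol] with ω h1 h2
      filter_upwards [h1.eventually hDe.eventually_right_inverse, h2] with n h3 h4
      exact perturbedMaximizer_injective hY hν hdens hε (h4.2.trans h3.symm)
    -- `hloc` uses injectivity on the whole space: it excludes minimizers far from `θ₀`
    have hclt := tendstoInDistribution_sqrt_smul_sampleMean_sub hL2 hindep hlaw
    rw [hmean] at hclt
    have hdelta := tendstoInDistribution_delta_method hDe.to_localInverse.hasFDerivAt
      (aemeasurable_sampleMean fun i => (hlaw i).aemeasurable) hmeas
      (fun n => Real.sqrt_nonneg _) hslln hloc hclt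
    rw [hDe.localInverse_apply_image] at hdelta
    have hmap := multivariateGaussian_zero_map_toEuclideanCLM
      (posSemidef_covarianceMatrix hL2) H⁻¹
    rw [Matrix.transpose_nonsing_inv, hsymm] at hmap
    refine ⟨hdelta.forall_aemeasurable, aemeasurable_id, ?_⟩
    convert hdelta.tendsto using 2
    refine congrArg 𝓝 (Subtype.ext ?_)
    change Measure.map id _ = Measure.map (Matrix.toEuclideanCLM (𝕜 := ℝ) H⁻¹) _
    rw [hmap, Measure.map_id]
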